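/- **Main Theorem.** A quasigroup is a set $Q$ with a binary operation (written by juxtaposition) such that for all $a,b\in Q$ the equations $ax=b$ and $ya=b$ have unique solutions; let $\alpha,\beta:Q\to Q$ be given by $x\,\alpha(x)=x=\beta(x)\,x$. An F-quasigroup is a quasigroup satisfying $$x\cdot yz=xy\cdot\alpha(x)z,\qquad zy\cdot x=z\beta(x)\cdot yx .$$ Put $M(Q)=\{a\in Q: xa\cdot yx=xy\cdot ax\ \ \forall x,y\in Q\}$. Let $\mathcal F_p$ be the class of pairs $(Q,a)$ with $Q$ an F-quasigroup and $a\in Q$ (a category under homomorphisms preserving the distinguished element), and let $\mathcal F_m$ consist of those $(Q,a)$ with $a\in M(Q)$. A loop $(Q,+)$ is a (not necessarily commutative or associative) quasigroup with two-sided neutral element $0$. Let $$N(Q)=\{a: (a+x)+y=a+(x+y),\ (x+a)+y=x+(a+y),\ (x+y)+a=x+(y+a)\ \ \forall x,y\in Q\},$$ $$K(Q)=\{a: (a+a)+(x+y)=(a+x)+(a+y)\ \ \forall x,y\in Q\},\qquad Z(Q)=N(Q)\cap K(Q).$$ An NK-loop is a loop in which every element is $n+k$ for some $n\in N(Q)$,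 $k\in K(Q)$. For an associative ring $R$, possibly without unity, a generalized $R$-module is an NK-loop $(Q,+)$ with a map $R\times Q\to Q$ such that for all $a,b\in R$, $x,y\in Q$, $z\in N(Q)$, $w\in K(Q)$: $a(x+y)=ax+ay$; $(a+b)x=ax+bx$; $a(bx)=(ab)x$; $ax\in K(Q)$; $az\in N(Q)$; and there is $m\in\mathbb Z$ with $mw+aw\in Z(Q)$. Let $\mathbf R$ be the free commutative associative ring without unity on $\mathbf x,\mathbf y,\mathbf u,\mathbf v$, i.e. the ideal of $\mathbb Z[\mathbf x,\mathbf y,\mathbf u,\mathbf v]$ generated by the indeterminates. Let $\mathcal M$ be the class of generalized $\mathbf R$-modules $Q$ such that $2z+\mathbf xz\in N(Q)$ and $2z+\mathbf yz\in N(Q)$ for all $z\in Q$, and $\mathbf x+\mathbf u+\mathbf x\mathbf u$ and $\mathbf y+\mathbf v+\mathbf y\mathbf v$ annihilate $Q$. Let $\mathcal M_n$ be the class of pairs $(Q,e)$ with $Q\in\mathcal M$ and $e\in N(Q)$ (a category under additive maps that commute with scalars and preserve the distinguished element), and let $\mathcal M_c$ consist of those with $e\in Z(Q)$. Then the equational classes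 $\mathcal F_p$ and $\mathcal M_n$ are equivalent: there is an equivalence of categories $E:\mathcal F_p\to\mathcal M_n$ which, up to a natural bijection, preserves underlying sets and maps, and under which every basic operation of $\mathcal M_n$ (addition, its left and right subtractions, $0$, $e$, each scalar multiplication) is given by a term in the operations of $\mathcal F_p$ (multiplication, left and right division, the distinguished element), and conversely, the terms being the same for all objects. Moreover $E$ restricts to an equivalence between $\mathcal F_m$ and $\mathcal M_c$; in particular $(Q,a)\in\mathcal F_m$ if and only if $E(Q,a)\in\mathcal M_c$. -/

import Mathlib

open CategoryTheory

universe u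

namespace FQuasi

/-! ### Quasigroups and F-quasigroups -/

/-- A quasigroup: a binary operation such that `a * x = b` and `y * a = b` have unique solutions. -/
class Quasigroup (Q : Type u) extends Mul Q where
  existsUnique_mul_left : ∀ a b : Q, ∃! x : Q, a * x = b
  existsUnique_mul_right : ∀ a b : Q, ∃! y : Q, y * a = b

section Quasigroup

variable {Q : Type u} [Quasigroup Q]

/-- Left division `a \ b`: the unique `x` with `a * x = b`. -/
noncomputable def ldiv (a b : Q) : Q := (Quasigroup.existsUnique_mul_left a b).choose

/-- Right division `b / a`: the unique `y` with `y * a = b`. -/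
noncomputable def rdiv (b a : Q) : Q := (Quasigroup.existsUnique_mul_right a b).choose

theorem mul_ldiv (a b : Q) : a * ldiv a b = b :=
  (Quasigroup.existsUnique_mul_left a b).choose_spec.1

theorem rdiv_mul (b a : Q) : rdiv b a * a = b :=
  (Quasigroup.existsUnique_mul_right a b).choose_spec.1

/-- The map `α`, characterized by `x * α x = x`. -/
noncomputable def alpha (x : Q) : Q := ldiv x x

/-- The map `β`, characterized by `β x * x = x`. -/
noncomputable def beta (x : Q) : Q := rdiv x x

end Quasigroup

/-- An F-quasigroup: a quasigroup with `x · yz = xy · α(x)z` and `zy · x = zβ(x) · yx`. -/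
class FQuasigroup (Q : Type u) extends Quasigroup Q where
  left_F : ∀ x y z : Q, x * (y * z) = (x * y) * (alpha x * z)
  right_F : ∀ x y z : Q, (z * y) * x = (z * beta x) * (y * x)

/-- `M(Q) = {a | xa · yx = xy · ax for all x, y}`. -/
def mSet (Q : Type u) [Quasigroup Q] : Set Q :=
  {a | ∀ x y : Q, (x * a) * (y * x) = (x * y) * (a * x)}

/-! ### Loops and NK-loops -/

/-- A loop, written additively (not assumed commutative or associative): a quasigroup with a
two-sided neutral element `0`. -/
class AddLoop (Q : Type u) extends Add Q, Zero Q where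
  zero_add : ∀ a : Q, 0 + a = a
  add_zero : ∀ a : Q, a + 0 = a
  existsUnique_add_left : ∀ a b : Q, ∃! x : Q, a + x = b
  existsUnique_add_right : ∀ a b : Q, ∃! y : Q, y + a = b

section Loop

variable {Q : Type u} [AddLoop Q]

/-- The unique `x` with `a + x = b`. -/
noncomputable def lsub (a b : Q) : Q := (AddLoop.existsUnique_add_left a b).choose

/-- The unique `y` with `y + a = b`. -/
noncomputable def rsub (b a : Q) : Q := (AddLoop.existsUnique_add_right a b).choose

theorem add_lsub (a b : Q) : a + lsub a b = b :=
  (AddLoop.existsUnique_add_left a b).choose_spec.1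

theorem rsub_add (b a : Q) : rsub b a + a = b :=
  (AddLoop.existsUnique_add_right a b).choose_spec.1

/-- The inverse of `a`: the unique `x` with `a + x = 0` (inverses are two-sided in NK-loops). -/
noncomputable def lneg (a : Q) : Q := lsub a 0

/-- `n x = x + (x + (⋯ + x))` for a natural number `n`. The bracketing is immaterial in
diassociative loops, hence in NK-loops. -/
def nmul : ℕ → Q → Q
  | 0, _ => 0
  | n + 1, x => x + nmul n x

/-- `m x` for an integer `m`. -/
noncomputable def zmul : ℤ → Q → Q
  | Int.ofNat n, x => nmul n x
  | Int.negSucc n, x => nmul (n + 1) (lneg x)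

variable (Q)

/-- The nucleus `N(Q,+)`. -/
def nucleus : Set Q :=
  {a | ∀ x y : Q, (a + x) + y = a + (x + y) ∧ (x + a) + y = x + (a + y) ∧
    (x + y) + a = x + (y + a)}

/-- The Moufang center `K(Q,+)`. -/
def moufangCenter : Set Q :=
  {a | ∀ x y : Q, (a + a) + (x + y) = (a + x) + (a + y)}

/-- The center `Z(Q,+) = N(Q,+) ∩ K(Q,+)`. -/
def center : Set Q := nucleus Q ∩ moufangCenter Q

end Loop

/-- An NK-loop: every element is the sum of an element of the nucleus and an element of the
Moufang center (these two automatically commute). -/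
class NKLoop (Q : Type u) extends AddLoop Q where
  exists_nucleus_add_moufangCenter :
    ∀ x : Q, ∃ n ∈ nucleus Q, ∃ k ∈ moufangCenter Q, x = n + k

/-! ### Generalized modules -/

/-- A generalized (left) module over an associative ring `R`, possibly without unity. -/
class GenModule (R : Type*) [NonUnitalRing R] (Q : Type u) [NKLoop Q]
    extends SMul R Q where
  smul_add : ∀ (a : R) (x y : Q), a • (x + y) = a • x + a • y
  add_smul : ∀ (a b : R) (x : Q), (a + b) • x = a • x + b • x
  smul_smul : ∀ (a b : R) (x : Q), a • (b • x) = (a * b) • x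
  smul_mem_moufangCenter : ∀ (a : R) (x : Q), a • x ∈ moufangCenter Q
  smul_mem_nucleus : ∀ (a : R) (z : Q), z ∈ nucleus Q → a • z ∈ nucleus Q
  exists_zmul_add_smul_mem_center :
    ∀ (a : R) (w : Q), w ∈ moufangCenter Q → ∃ m : ℤ, zmul m w + a • w ∈ center Q

/-- The annihilator `Ann(Q) = {a ∈ R | aQ = 0}`. -/
def annihilator (R : Type*) [NonUnitalRing R] (Q : Type u) [NKLoop Q]
    [GenModule R Q] : Set R :=
  {a | ∀ q : Q, a • q = 0}

/-- The ideal of `ℤ[x, y, u, v]` generated by the indeterminates. -/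
noncomputable def augIdeal : Ideal (MvPolynomial (Fin 4) ℤ) :=
  Ideal.span (Set.range MvPolynomial.X)

/-- The free commutative associative ring without unity on `x`, `y`, `u`, `v`. -/
abbrev FreeR : Type := augIdeal

/-- The four free generators; indices `0, 1, 2, 3` stand for `x`, `y`, `u`, `v`. -/
noncomputable def gen (i : Fin 4) : FreeR :=
  ⟨MvPolynomial.X i, Ideal.subset_span ⟨i, rfl⟩⟩

/-- The objects of the class `𝓜`: generalized `FreeR`-modules with `2z + xz ∈ N`, `2z + yz ∈ N`
for all `z`, and with `x + u + xu` and `y + v + yv` in the annihilator. -/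
class MModule (Q : Type u) extends NKLoop Q, GenModule FreeR Q where
  two_add_x : ∀ z : Q, (z + z) + gen 0 • z ∈ nucleus Q
  two_add_y : ∀ z : Q, (z + z) + gen 1 • z ∈ nucleus Q
  ann_xu : gen 0 + gen 2 + gen 0 * gen 2 ∈ annihilator FreeR Q
  ann_yv : gen 1 + gen 3 + gen 1 * gen 3 ∈ annihilator FreeR Q

/-! ### The category of pointed F-quasigroups -/

/-- A pointed F-quasigroup. -/
structure Fp : Type (u + 1) where
  carrier : Type u
  [str : FQuasigroup carrier]
  pt : carrier

attribute [instance] Fp.str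

namespace Fp

/-- Homomorphisms of pointed quasigroups (divisions are automatically preserved). -/
@[ext]
structure Hom (A B : Fp.{u}) where
  toFun : A.carrier → B.carrier
  map_mul : ∀ x y : A.carrier, toFun (x * y) = toFun x * toFun y
  map_pt : toFun A.pt = B.pt

instance : Category Fp.{u} where
  Hom A B := Hom A B
  id A := ⟨fun x => x, fun _ _ => rfl, rfl⟩
  comp f g := ⟨fun x => g.toFun (f.toFun x),
    fun x y => by rw [f.map_mul, g.map_mul], by rw [f.map_pt, g.map_pt]⟩

end Fp

/-- The class `𝓕_m`: those `(Q, a)` with `a ∈ M(Q)`. -/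
def isFm : ObjectProperty Fp.{u} := fun A => A.pt ∈ mSet A.carrier

/-! ### The category of nuclearly pointed objects of `𝓜` -/

/-- A nuclearly pointed object of `𝓜`. -/
structure Mn : Type (u + 1) where
  carrier : Type u
  [str : MModule carrier]
  pt : carrier
  pt_mem : pt ∈ nucleus carrier

attribute [instance] Mn.str

namespace Mn

/-- Homomorphisms of pointed generalized modules (`0` and subtractions are automatically
preserved). -/
@[ext]
structure Hom (A B : Mn.{u}) where
  toFun : A.carrier → B.carrier
  map_add : ∀ x y : A.carrier, toFun (x + y) = toFun x + toFun y
  map_smul : ∀ (r : FreeR) (x : A.carrier), toFun (r • x) = r • toFun x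
  map_pt : toFun A.pt = B.pt

instance : Category Mn.{u} where
  Hom A B := Hom A B
  id A := ⟨fun x => x, fun _ _ => rfl, fun _ _ => rfl, rfl⟩
  comp f g := ⟨fun x => g.toFun (f.toFun x),
    fun x y => by rw [f.map_add, g.map_add], fun r x => by rw [f.map_smul, g.map_smul],
    by rw [f.map_pt, g.map_pt]⟩

end Mn

/-- The class `𝓜_c`: those `(Q, e)` in `𝓜_n` with `e ∈ Z(Q,+)`; as `Z(Q,+) ⊆ N(Q,+)`, these are
all centrally pointed objects of `𝓜`. -/
def isMc : ObjectProperty Mn.{u} := fun B => B.pt ∈ center B.carrier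

/-! ### Equivalence of equational classes -/

/-- The operation symbols of pointed quasigroups. -/
inductive QOp : ℕ → Type
  | pt : QOp 0
  | mul : QOp 2
  | ldiv : QOp 2
  | rdiv : QOp 2

/-- The operation symbols of pointed generalized modules. -/
inductive MOp : ℕ → Type
  | zero : MOp 0
  | pt : MOp 0
  | add : MOp 2
  | lsub : MOp 2
  | rsub : MOp 2
  | smul (r : FreeR) : MOp 1

/-- The language of pointed quasigroups (no relation symbols). -/
def qLang : FirstOrder.Language.{0, 0} := ⟨QOp, fun _ => Empty⟩

/-- The language of pointed generalized modules (no relation symbols). -/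
def mLang : FirstOrder.Language.{0, 0} := ⟨MOp, fun _ => Empty⟩

/-- Interpretation of the operation symbols in a pointed F-quasigroup. -/
noncomputable def qFun (A : Fp.{u}) : ∀ {n : ℕ}, QOp n → (Fin n → A.carrier) → A.carrier
  | _, .pt, _ => A.pt
  | _, .mul, v => v 0 * v 1
  | _, .ldiv, v => ldiv (v 0) (v 1)
  | _, .rdiv, v => rdiv (v 0) (v 1)

/-- Interpretation of the operation symbols in a pointed generalized module. -/
noncomputable def mFun (B : Mn.{u}) : ∀ {n : ℕ}, MOp n → (Fin n → B.carrier) → B.carrier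
  | _, .zero, _ => 0
  | _, .pt, _ => B.pt
  | _, .add, v => v 0 + v 1
  | _, .lsub, v => lsub (v 0) (v 1)
  | _, .rsub, v => rsub (v 0) (v 1)
  | _, .smul r, v => r • v 0

noncomputable instance (A : Fp.{u}) : qLang.Structure A.carrier where
  funMap f v := qFun A f v
  RelMap r _ := r.elim

noncomputable instance (B : Mn.{u}) : mLang.Structure B.carrier where
  funMap f v := mFun B f v
  RelMap r _ := r.elim

/-- An equivalence between the equational classes `𝓕_p` and `𝓜_n`: an equivalence of categories
which (up to natural bijections `θ`) does not change underlying sets and maps, and under which the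
basic operations on either side are term operations on the other side, the terms being the same for
all objects. -/
structure EquationalEquivalence where
  /-- The equivalence of categories. -/
  equiv : Fp.{u} ≌ Mn.{u}
  /-- Corresponding objects have the same underlying set. -/
  θ (A : Fp.{u}) : A.carrier ≃ (equiv.functor.obj A).carrier
  /-- Corresponding morphisms have the same underlying map. -/
  θ_naturality {A B : Fp.{u}} (f : A ⟶ B) (x : A.carrier) :
    θ B (Fp.Hom.toFun f x) = Mn.Hom.toFun (equiv.functor.map f) (θ A x)
  /-- The operations of pointed F-quasigroups are given by terms of generalized modules. -/
  exists_mTerm {n : ℕ} (f : qLang.Functions n) : ∃ t : mLang.Term (Fin n),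
    ∀ (A : Fp.{u}) (v : Fin n → A.carrier),
      θ A (FirstOrder.Language.Structure.funMap f v) = t.realize (fun i => θ A (v i))
  /-- The operations of generalized modules are given by terms of pointed F-quasigroups. -/
  exists_qTerm {n : ℕ} (f : mLang.Functions n) : ∃ t : qLang.Term (Fin n),
    ∀ (A : Fp.{u}) (v : Fin n → A.carrier),
      FirstOrder.Language.Structure.funMap f (fun i => θ A (v i)) = θ A (t.realize v)

end FQuasi

open FQuasi

/-! Both classes describe the same data: an arithmetic form x * y = (f x + e) + g y on an NK-loop,
with e nuclear and f, g commuting automorphisms that, modulo the center, fix the nucleus N and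
invert the Moufang center K (`IsNegAut`).

From quasigroup to form. The F-laws say that translations are components of autotopisms (L_x,
L_{αx}, L_x) and (R_{βx}, R_x, R_x). Their commutators produce central permutations
(`isCentral_lmul`), so α and β are idempotent modulo central permutations, and a central twist
creates an idempotent t (`exists_idempotent_twist`). In the loop isotope at t, the translations f =
R_t and g = L_t are automorphisms. There α splits the loop, modulo the center, into kernel and image
(`exists_ker_add_idem`). The F-laws put the kernel into N (`ker_mem_nucleus`) and the image into K
(`idem_mem_moufangCenter`), and they determine f and g modulo the center. Undoing the twist and
translating the base point to the distinguished element changes only the constant e (`exists_form`).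

From form to module. Since 3k is central for k in K (`three_mem_center`), the map -1 + f is, modulo
the center, zero on N and -2 = 1 on K. Maps that are zero on N and an integer mod 3 on K, modulo the
center, form a ring `KEnd`, in which x, y, u, v are sent to -1 + f, -1 + g, -1 + f⁻¹, -1 + g⁻¹; the
annihilator conditions express (1 + x)(1 + u) = 1 = (1 + y)(1 + v). Conversely, the axioms of 𝓜 make
1 + x and 1 + y automorphisms of the required kind (`isNegAut_of_two_add`), and the F-laws for the
form reduce modulo the center to the Moufang identity (`exists_FQuasigroup`).

Terms and functors. With the distinguished element a as zero, f is right multiplication by α(a), g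
is left multiplication by β(a), and e = aa. Addition and the four generators are thus quasigroup
terms, hence so is every scalar. `Compat` records that A and B share a form; homomorphisms preserve
terms, so the same maps serve both categories. For the point 0, membership in M(Q) amounts to e
commuting with everything (`arithmeticForm_mem_mSet_iff`). -/

namespace FQuasi

/-! ### Loops: nucleus, Moufang center, center -/

section LoopBasics

variable {Q : Type u} [AddLoop Q]

@[simp] theorem loop_zero_add (a : Q) : 0 + a = a := AddLoop.zero_add a

@[simp] theorem loop_add_zero (a : Q) : a + 0 = a := AddLoop.add_zero a

theorem loop_add_left_cancel {a x y : Q} (h : a + x = a + y) : x = y :=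
  (AddLoop.existsUnique_add_left a (a + y)).unique h rfl

theorem loop_add_right_cancel {a x y : Q} (h : x + a = y + a) : x = y :=
  (AddLoop.existsUnique_add_right a (y + a)).unique h rfl

theorem eq_lsub {a b x : Q} (h : a + x = b) : x = lsub a b :=
  loop_add_left_cancel (h.trans (add_lsub a b).symm)

theorem eq_rsub {a b x : Q} (h : x + a = b) : x = rsub b a :=
  loop_add_right_cancel (h.trans (rsub_add b a).symm)

theorem add_lneg (a : Q) : a + lneg a = 0 := add_lsub a 0

theorem eq_lneg {a x : Q} (h : a + x = 0) : x = lneg a := eq_lsub h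

theorem lneg_zero : lneg (0 : Q) = 0 := (eq_lneg (loop_zero_add 0)).symm

section Nucleus

variable {n : Q} (hn : n ∈ nucleus Q)
include hn

theorem nuc_left (x y : Q) : (n + x) + y = n + (x + y) := (hn x y).1

theorem nuc_mid (x y : Q) : (x + n) + y = x + (n + y) := (hn x y).2.1

theorem nuc_right (x y : Q) : (x + y) + n = x + (y + n) := (hn x y).2.2

end Nucleus

theorem zero_mem_nucleus : (0 : Q) ∈ nucleus Q := fun x y => by simp

theorem add_mem_nucleus {n m : Q} (hn : n ∈ nucleus Q) (hm : m ∈ nucleus Q) :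
    n + m ∈ nucleus Q := fun x y => by
  refine ⟨?_, ?_, ?_⟩
  · rw [nuc_left hn, nuc_left hn, nuc_left hm, nuc_left hn]
  · rw [← nuc_mid hn, nuc_mid hm, nuc_mid hn, nuc_left hn]
  · rw [← nuc_right hm (x + y) n, nuc_right hn, nuc_right hm, nuc_right hm]

theorem lneg_add_of_nuc {n : Q} (hn : n ∈ nucleus Q) : lneg n + n = 0 := by
  apply loop_add_left_cancel (a := n)
  rw [← nuc_left hn, add_lneg, loop_zero_add, loop_add_zero]

theorem lneg_add_cancel_of_nuc {n : Q} (hn : n ∈ nucleus Q) (x : Q) : lneg n + (n + x) = x := by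
  rw [← nuc_mid hn, lneg_add_of_nuc hn, loop_zero_add]

theorem add_lneg_cancel_of_nuc {n : Q} (hn : n ∈ nucleus Q) (x : Q) : n + (lneg n + x) = x := by
  apply loop_add_left_cancel (a := lneg n)
  rw [lneg_add_cancel_of_nuc hn]

theorem lneg_mem_nucleus {n : Q} (hn : n ∈ nucleus Q) : lneg n ∈ nucleus Q := fun x y => by
  have key : ∀ x, (x + n) + lneg n = x := fun x => by
    rw [nuc_mid hn, add_lneg, loop_add_zero]
  have key' : ∀ x, (x + lneg n) + n = x := fun x => by
    rw [nuc_right hn, lneg_add_of_nuc hn, loop_add_zero]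
  refine ⟨?_, ?_, ?_⟩
  · apply loop_add_left_cancel (a := n)
    rw [← nuc_left hn, add_lneg_cancel_of_nuc hn, add_lneg_cancel_of_nuc hn]
  · have : x = (x + lneg n) + n := (key' x).symm
    conv_rhs => rw [this]
    rw [nuc_mid hn, add_lneg_cancel_of_nuc hn]
  · apply loop_add_right_cancel (a := n)
    rw [key', nuc_right hn, key']

theorem lneg_lneg_of_nuc {n : Q} (hn : n ∈ nucleus Q) : lneg (lneg n) = n :=
  (eq_lneg (lneg_add_of_nuc hn)).symm

/-! #### The Moufang center -/

section MoufangCenter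

/-- The right-hand side says that (L_c, L_c, L_c²) is an autotopism, a form that is stable under
composing translations. -/
theorem mem_moufangCenter_iff {c : Q} :
    c ∈ moufangCenter Q ↔ ∀ x y : Q, (c + x) + (c + y) = c + (c + (x + y)) := by
  constructor
  · intro h
    have h1 : ∀ y, (c + c) + y = c + (c + y) := fun y => by
      have := h 0 y
      simpa using this
    intro x y
    rw [← h1, h]
  · intro h
    have h0 : ∀ x, (c + x) + c = c + (c + x) := fun x => by simpa using h x 0
    have h1 : ∀ w, (c + c) + w = c + (c + w) := fun w => by
      have := h c (lsub c w)
      rwa [add_lsub] at this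
    intro x y
    rw [h1, h]

variable {c : Q} (hc : c ∈ moufangCenter Q)
include hc

theorem mou_two (x y : Q) : (c + x) + (c + y) = (c + c) + (x + y) := (hc x y).symm

theorem mou_alt (x : Q) : (c + c) + x = c + (c + x) := by simpa using hc 0 x

theorem mou_comm (x : Q) : c + x = x + c := by
  have h0 : ∀ x, (c + x) + c = c + (c + x) := fun x => by
    have := mem_moufangCenter_iff.1 hc x 0
    simpa using this
  have := h0 (lsub c x)
  rw [add_lsub] at this
  exact this.symm

theorem mou_lneg_add : lneg c + c = 0 := by rw [← mou_comm hc, add_lneg]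

/-- The Moufang identity applied to -c and x gives c + x = 2c + (-c + x). Putting c + x for x and
comparing with 2c + x = c + (c + x) allows 2c to be cancelled. -/
theorem mou_lneg_add_cancel (x : Q) : lneg c + (c + x) = x := by
  apply loop_add_left_cancel (a := c + c)
  have h := mou_two hc (lneg c) x
  rw [add_lneg, loop_zero_add] at h
  have h2 := mou_two hc (lneg c) (c + x)
  rw [add_lneg, loop_zero_add] at h2
  rw [← h2, mou_alt hc]

theorem mou_add_lneg_cancel (x : Q) : c + (lneg c + x) = x := by
  obtain ⟨y, rfl⟩ : ∃ y, c + y = x := ⟨_, add_lsub c x⟩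
  rw [mou_lneg_add_cancel hc]

theorem lneg_mem_moufangCenter : lneg c ∈ moufangCenter Q := by
  rw [mem_moufangCenter_iff]
  intro x y
  apply loop_add_left_cancel (a := c + c)
  rw [← mou_two hc, mou_add_lneg_cancel hc, mou_add_lneg_cancel hc, mou_alt hc,
    mou_add_lneg_cancel hc, mou_add_lneg_cancel hc]

theorem mou_lneg_lneg : lneg (lneg c) = c := (eq_lneg (mou_lneg_add hc)).symm

theorem mou_add_add_lneg_cancel (x : Q) : (x + c) + lneg c = x := by
  rw [← mou_comm (lneg_mem_moufangCenter hc), ← mou_comm hc, mou_lneg_add_cancel hc]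

theorem mou_add_lneg_add_cancel (x : Q) : (x + lneg c) + c = x := by
  rw [← mou_comm (lneg_mem_moufangCenter hc), ← mou_comm hc, mou_add_lneg_cancel hc]

end MoufangCenter

theorem zero_mem_moufangCenter : (0 : Q) ∈ moufangCenter Q := fun x y => by simp

theorem add_mem_moufangCenter {k l : Q} (hk : k ∈ moufangCenter Q) (hl : l ∈ moufangCenter Q) :
    k + l ∈ moufangCenter Q := by
  -- `k + l` acts as `L_k² L_l L_k⁻¹`
  have key : ∀ y, (k + l) + y = k + (k + (l + (lneg k + y))) := fun y => by
    have := mou_two hk l (lneg k + y)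
    rw [mou_add_lneg_cancel hk] at this
    rw [this, mou_alt hk]
  have key' : ∀ y, (k + l) + y = l + (l + (k + (lneg l + y))) := fun y => by
    have := mou_two hl k (lneg l + y)
    rw [mou_add_lneg_cancel hl, mou_comm hl k] at this
    rw [this, mou_alt hl]
  have K := mem_moufangCenter_iff.1 hk
  have L := mem_moufangCenter_iff.1 hl
  have K' := mem_moufangCenter_iff.1 (lneg_mem_moufangCenter hk)
  -- the image of the autotopism `L_k² L_l L_k⁻¹`
  have auto : ∀ x y, ((k + l) + x) + ((k + l) + y) =
      k + (k + (k + (k + (l + (l + (lneg k + (lneg k + (x + y)))))))) := fun x y => by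
    rw [key x, key y, K, K, L, K']
  -- At x = 0 the third component of the autotopism is seen to be the square of the translation by k
  -- + l.
  have diag : ∀ y, (k + l) + ((k + l) + y) =
      k + (k + (k + (k + (l + (l + (lneg k + (lneg k + y))))))) := fun y => by
    simpa using auto 0 y
  rw [mem_moufangCenter_iff]
  intro x y
  rw [auto, diag]

theorem lneg_add_of_mou {k l : Q} (hk : k ∈ moufangCenter Q) (hl : l ∈ moufangCenter Q) :
    lneg (k + l) = lneg k + lneg l := by
  have hr := add_mem_moufangCenter hk hl
  have h1 : (k + l) + lneg k = l := by
    rw [← mou_comm (lneg_mem_moufangCenter hk), mou_lneg_add_cancel hk]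
  have h2 := mou_lneg_add_cancel hr (lneg k)
  rw [h1] at h2
  rw [← h2, mou_add_add_lneg_cancel hl]

/-! #### The center -/

section Center

variable {z : Q} (hz : z ∈ center Q)
include hz

theorem cen_comm (x : Q) : z + x = x + z := mou_comm hz.2 x

theorem cen_left (x y : Q) : (z + x) + y = z + (x + y) := nuc_left hz.1 x y

theorem cen_mid (x y : Q) : x + (z + y) = z + (x + y) := by
  rw [← nuc_mid hz.1, ← cen_comm hz, nuc_left hz.1]

theorem cen_add_left (x y : Q) : (x + z) + y = (x + y) + z := by
  rw [← cen_comm hz, cen_left hz, cen_comm hz]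

theorem cen_add_right (x y : Q) : x + (y + z) = (x + y) + z := (nuc_right hz.1 x y).symm

end Center

theorem cen_add_add {z w : Q} (hz : z ∈ center Q) (hw : w ∈ center Q) (x y : Q) :
    (x + z) + (y + w) = (x + y) + (z + w) := by
  rw [cen_add_left hz, cen_add_right hw, nuc_mid hw.1, cen_comm hz]

theorem center_of_nuc {z : Q} (hn : z ∈ nucleus Q) (h2 : ∀ x : Q, z + x = x + z) :
    z ∈ center Q := by
  refine ⟨hn, fun x y => ?_⟩
  rw [nuc_left hn, nuc_left hn, ← nuc_mid hn x y, ← h2 x, nuc_left hn]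

theorem mem_center_of {z : Q} (h1 : ∀ x y : Q, (z + x) + y = z + (x + y))
    (h2 : ∀ x : Q, z + x = x + z) (h3 : ∀ x y : Q, x + (z + y) = z + (x + y)) : z ∈ center Q := by
  refine center_of_nuc (fun x y => ⟨h1 x y, ?_, ?_⟩) h2
  · rw [← h2, h1, h3]
  · rw [← h2, ← h2, h3]

theorem zero_mem_center : (0 : Q) ∈ center Q := ⟨zero_mem_nucleus, zero_mem_moufangCenter⟩

theorem add_mem_center {z w : Q} (hz : z ∈ center Q) (hw : w ∈ center Q) : z + w ∈ center Q :=
  ⟨add_mem_nucleus hz.1 hw.1, add_mem_moufangCenter hz.2 hw.2⟩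

theorem lneg_mem_center {z : Q} (hz : z ∈ center Q) : lneg z ∈ center Q :=
  ⟨lneg_mem_nucleus hz.1, lneg_mem_moufangCenter hz.2⟩

/-- Nuclear and Moufang central parts add up independently. -/
theorem add_add_add_of_nuc_mou {n m k : Q} (hn : n ∈ nucleus Q) (hm : m ∈ nucleus Q)
    (hk : k ∈ moufangCenter Q) (l : Q) : (n + k) + (m + l) = (n + m) + (k + l) := by
  rw [nuc_left hn, ← nuc_mid hm, mou_comm hk m, nuc_left hm, nuc_left hn]

end LoopBasics

/-! ### NK-loops -/

section NK

variable {Q : Type u} [NKLoop Q]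

theorem lneg_add_of_nuc_mou {n k : Q} (hn : n ∈ nucleus Q) (hk : k ∈ moufangCenter Q) :
    lneg (n + k) = lneg n + lneg k := by
  refine (eq_lneg ?_).symm
  rw [add_add_add_of_nuc_mou hn (lneg_mem_nucleus hn) hk, add_lneg, add_lneg, loop_zero_add]

theorem nk_cases (x : Q) : ∃ n ∈ nucleus Q, ∃ k ∈ moufangCenter Q, x = n + k :=
  NKLoop.exists_nucleus_add_moufangCenter x

theorem nk_lneg_add (x : Q) : lneg x + x = 0 := by
  obtain ⟨n, hn, k, hk, rfl⟩ := nk_cases x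
  rw [lneg_add_of_nuc_mou hn hk, add_add_add_of_nuc_mou (lneg_mem_nucleus hn) hn
    (lneg_mem_moufangCenter hk), lneg_add_of_nuc hn, mou_lneg_add hk, loop_zero_add]

theorem nk_lneg_lneg (x : Q) : lneg (lneg x) = x := (eq_lneg (nk_lneg_add x)).symm

theorem nk_lneg_add_cancel (x y : Q) : lneg x + (x + y) = y := by
  obtain ⟨n, hn, k, hk, rfl⟩ := nk_cases x
  rw [lneg_add_of_nuc_mou hn hk, nuc_left hn, ← nuc_mid hn,
    nuc_left (lneg_mem_nucleus hn), mou_comm (lneg_mem_moufangCenter hk), ← nuc_left (lneg_mem_nucleus hn),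
    lneg_add_of_nuc hn, loop_zero_add, mou_lneg_add_cancel hk]

theorem nk_add_lneg_cancel (x y : Q) : x + (lneg x + y) = y := by
  apply loop_add_left_cancel (a := lneg x)
  rw [nk_lneg_add_cancel]

theorem nk_add_add_lneg (x y : Q) : (x + y) + lneg y = x := by
  obtain ⟨n, hn, k, hk, rfl⟩ := nk_cases y
  rw [lneg_add_of_nuc_mou hn hk, ← mou_comm (lneg_mem_moufangCenter hk), ← nuc_mid hn,
    ← nuc_right (lneg_mem_nucleus hn), mou_add_add_lneg_cancel hk,
    nuc_mid hn, add_lneg, loop_add_zero]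

theorem lneg_mou_add_lneg {k : Q} (hk : k ∈ moufangCenter Q) (y : Q) :
    lneg (k + lneg y) = lneg k + y := by
  obtain ⟨n, hn, l, hl, rfl⟩ := nk_cases y
  rw [lneg_add_of_nuc_mou hn hl, ← nuc_mid (lneg_mem_nucleus hn), mou_comm hk,
    nuc_left (lneg_mem_nucleus hn), lneg_add_of_nuc_mou (lneg_mem_nucleus hn)
    (add_mem_moufangCenter hk (lneg_mem_moufangCenter hl)),
    lneg_add_of_mou hk (lneg_mem_moufangCenter hl), mou_lneg_lneg hl, lneg_lneg_of_nuc hn,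
    ← nuc_mid hn, mou_comm (lneg_mem_moufangCenter hk) n, nuc_left hn]

theorem nk_lneg_add_distrib (x y : Q) : lneg (x + y) = lneg y + lneg x := by
  have h := nk_lneg_add_cancel (x + y) (lneg y)
  rw [nk_add_add_lneg] at h
  rw [← h, nk_add_add_lneg]

/-- `(2k + x) + (-k + y) = k + (x + y)`. -/
theorem mou_two_add_lneg {k : Q} (hk : k ∈ moufangCenter Q) (x y : Q) :
    ((k + k) + x) + (lneg k + y) = k + (x + y) := by
  have h := mou_two hk (x + y) (lneg y)
  rw [nk_add_add_lneg] at h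
  rw [← h, ← lneg_mou_add_lneg hk, nk_add_add_lneg]

/-- The inverse property turns the autotopism (L_k, L_k, L_k²) into (L_{-k}, L_{2k}, L_k). -/
theorem mou_lneg_add_two {k : Q} (hk : k ∈ moufangCenter Q) (x y : Q) :
    (lneg k + x) + ((k + k) + y) = k + (x + y) := by
  have h := mou_two hk (lneg x) (x + y)
  rw [nk_lneg_add_cancel] at h
  rw [← h, ← lneg_mou_add_lneg hk, nk_lneg_add_cancel]

/-- Composing (L_k, L_k, L_k²) with (L_{2k}, L_{-k}, L_k) leaves the second component trivial. -/
theorem three_add_aux {k : Q} (hk : k ∈ moufangCenter Q) (x y : Q) :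
    (k + ((k + k) + x)) + y = (k + k) + (k + (x + y)) := by
  have := mou_two hk ((k + k) + x) (lneg k + y)
  rwa [mou_add_lneg_cancel hk, mou_two_add_lneg hk] at this

theorem three_add {k : Q} (hk : k ∈ moufangCenter Q) (y : Q) :
    (k + (k + k)) + y = (k + k) + (k + y) := by
  simpa using three_add_aux hk 0 y

/-- Both inverse-property companions of (L_k, L_k, L_k²), composed with it, give autotopisms with
one trivial component, so 3k can be moved out of either summand. This is the source of all
arithmetic modulo 3 below. -/
theorem three_mem_center {k : Q} (hk : k ∈ moufangCenter Q) : k + (k + k) ∈ center Q := by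
  have h3 : ∀ y, k + ((k + k) + y) = (k + k) + (k + y) := fun y => by
    simpa using three_add_aux hk y 0
  have h4 : ∀ x y, x + (k + ((k + k) + y)) = (k + k) + (k + (x + y)) := fun x y => by
    have := mou_two hk (lneg k + x) ((k + k) + y)
    rwa [mou_add_lneg_cancel hk, mou_lneg_add_two hk] at this
  have hK := add_mem_moufangCenter hk (add_mem_moufangCenter hk hk)
  refine mem_center_of (fun x y => ?_) (mou_comm hK) fun x y => ?_
  · rw [three_add hk (x + y), ← three_add_aux hk, h3, three_add hk]
  · rw [three_add hk, three_add hk, ← h3, h4]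

end NK

/-! ### Additive maps and congruence modulo the center -/

section AdditiveMaps

variable {Q : Type u} [AddLoop Q]

section

variable {f : Q → Q} (hf : ∀ x y, f (x + y) = f x + f y)
include hf

theorem additive_zero : f 0 = 0 := by
  have h := hf 0 0
  rw [loop_zero_add] at h
  exact (loop_add_left_cancel (h.symm.trans (loop_add_zero _).symm))

theorem additive_lneg (x : Q) : f (lneg x) = lneg (f x) := by
  apply eq_lneg
  rw [← hf, add_lneg, additive_zero hf]

variable (hb : Function.Bijective f)
include hb

theorem additive_mem_nucleus_iff {n : Q} : f n ∈ nucleus Q ↔ n ∈ nucleus Q := by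
  constructor
  · intro h x y
    refine ⟨?_, ?_, ?_⟩ <;> apply hb.1 <;> simp only [hf]
    · exact nuc_left h _ _
    · exact nuc_mid h _ _
    · exact nuc_right h _ _
  · intro h x y
    obtain ⟨x, rfl⟩ := hb.2 x
    obtain ⟨y, rfl⟩ := hb.2 y
    simp only [← hf, nuc_left h, nuc_mid h, nuc_right h, and_self]

theorem additive_mem_moufangCenter_iff {k : Q} :
    f k ∈ moufangCenter Q ↔ k ∈ moufangCenter Q := by
  constructor
  · intro h x y
    apply hb.1
    simp only [hf]
    exact h _ _
  · intro h x y
    obtain ⟨x, rfl⟩ := hb.2 x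
    obtain ⟨y, rfl⟩ := hb.2 y
    simp only [← hf, h x y]

theorem additive_mem_center_iff {z : Q} : f z ∈ center Q ↔ z ∈ center Q :=
  and_congr (additive_mem_nucleus_iff hf hb) (additive_mem_moufangCenter_iff hf hb)

end

/-- Congruence modulo the center. -/
def CenRel (x y : Q) : Prop := ∃ z ∈ center Q, x = y + z

theorem CenRel.symm {x y : Q} (h : CenRel x y) : CenRel y x := by
  obtain ⟨z, hz, rfl⟩ := h
  exact ⟨lneg z, lneg_mem_center hz, by rw [nuc_mid hz.1, add_lneg, loop_add_zero]⟩

theorem CenRel.trans {x y w : Q} (h : CenRel x y) (h' : CenRel y w) : CenRel x w := by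
  obtain ⟨z, hz, rfl⟩ := h
  obtain ⟨z', hz', rfl⟩ := h'
  exact ⟨z' + z, add_mem_center hz' hz, nuc_mid hz'.1 _ _⟩

theorem CenRel.add {x y x' y' : Q} (h : CenRel x y) (h' : CenRel x' y') :
    CenRel (x + x') (y + y') := by
  obtain ⟨z, hz, rfl⟩ := h
  obtain ⟨z', hz', rfl⟩ := h'
  exact ⟨z + z', add_mem_center hz hz', cen_add_add hz hz' _ _⟩

theorem CenRel.lneg {x y : Q} (h : CenRel x y) : CenRel (lneg x) (lneg y) := by
  obtain ⟨z, hz, rfl⟩ := h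
  refine ⟨FQuasi.lneg z, lneg_mem_center hz, (eq_lneg ?_).symm⟩
  rw [cen_add_left hz, cen_add_right (lneg_mem_center hz), add_lneg, loop_zero_add,
    lneg_add_of_nuc hz.1]

theorem CenRel.map {f : Q → Q} (hf : ∀ x y, f (x + y) = f x + f y) (hb : Function.Bijective f)
    {x y : Q} (h : CenRel x y) : CenRel (f x) (f y) := by
  obtain ⟨z, hz, rfl⟩ := h
  exact ⟨f z, (additive_mem_center_iff hf hb).2 hz, hf _ _⟩

theorem CenRel.of_map {f : Q → Q} (hf : ∀ x y, f (x + y) = f x + f y) (hb : Function.Bijective f)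
    {x y : Q} (h : CenRel (f x) (f y)) : CenRel x y := by
  obtain ⟨z, hz, h⟩ := h
  obtain ⟨w, rfl⟩ := hb.2 z
  exact ⟨w, (additive_mem_center_iff hf hb).1 hz, hb.1 (by rw [h, hf])⟩

theorem cenRel_of_mem {z w : Q} (hz : z ∈ center Q) (hw : w ∈ center Q) : CenRel z w :=
  ⟨lneg w + z, add_mem_center (lneg_mem_center hw) hz, (add_lneg_cancel_of_nuc hw.1 _).symm⟩

theorem CenRel.mem {z w : Q} (h : CenRel z w) (hw : w ∈ center Q) : z ∈ center Q := by
  obtain ⟨c, hc, rfl⟩ := h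
  exact add_mem_center hw hc

end AdditiveMaps

/-! ### Loops with a pair of automorphisms satisfying the F-laws -/

/-- The loop form of the F-laws for `x * y = f x + g y`. -/
structure IsFLoop {Q : Type u} [AddLoop Q] (f g α β : Q → Q) : Prop where
  f_add : ∀ x y, f (x + y) = f x + f y
  g_add : ∀ x y, g (x + y) = g x + g y
  f_bij : Function.Bijective f
  g_bij : Function.Bijective g
  α_add : ∀ x y, α (x + y) = α x + α y
  f_α : ∀ x, f (α x) = α (f x)
  g_α : ∀ x, g (α x) = α (g x)
  α_β : ∀ x, α (β x) = β (α x)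
  left_law : ∀ x y z, x + (y + z) = (f x + y) + (g (α x) + z)
  right_law : ∀ x y z, (y + z) + x = (y + f (β x)) + (z + g x)
  α_α : ∀ x, CenRel (α (α x)) (α x)
  β_β : ∀ x, CenRel (β (β x)) (β x)

namespace IsFLoop

variable {Q : Type u} [AddLoop Q] {f g α β : Q → Q} (H : IsFLoop f g α β)
include H

theorem f_add_α (x : Q) : f x + g (α x) = x := by simpa using (H.left_law x 0 0).symm

theorem β_add_g (x : Q) : f (β x) + g x = x := by simpa using (H.right_law x 0 0).symm

theorem α_mem_center {z : Q} (hz : z ∈ center Q) : α z ∈ center Q := by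
  have hfz := (additive_mem_center_iff H.f_add H.f_bij).2 hz
  rw [← additive_mem_center_iff H.g_add H.g_bij]
  have h := lneg_add_cancel_of_nuc hfz.1 (g (α z))
  rw [H.f_add_α] at h
  rw [← h]
  exact add_mem_center (lneg_mem_center hfz) hz

/-- The element βx decomposes as f(ββx) + g(βx) and as f(βx) + g(αβx); since ββx and βx agree modulo
the center, so do g(βx) and g(αβx). -/
theorem α_β_rel (x : Q) : CenRel (α (β x)) (β x) := by
  obtain ⟨z, hz, h⟩ := H.β_β x
  have h1 := H.β_add_g (β x)
  rw [h, H.f_add, nuc_mid ((additive_mem_center_iff H.f_add H.f_bij).2 hz).1] at h1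
  have h2 := loop_add_left_cancel (h1.trans (H.f_add_α (β x)).symm)
  refine CenRel.of_map H.g_add H.g_bij ⟨f z, (additive_mem_center_iff H.f_add H.f_bij).2 hz, ?_⟩
  rw [← h2, cen_comm ((additive_mem_center_iff H.f_add H.f_bij).2 hz)]

theorem β_α_rel (x : Q) : CenRel (β (α x)) (α x) := by
  obtain ⟨z, hz, h⟩ := H.α_α x
  have hgz := (additive_mem_center_iff H.g_add H.g_bij).2 hz
  have h1 := H.f_add_α (α x)
  rw [h, H.g_add, ← cen_comm hgz, ← nuc_mid hgz.1] at h1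
  have h2 := loop_add_right_cancel (h1.trans (H.β_add_g (α x)).symm)
  exact CenRel.of_map H.f_add H.f_bij ⟨g z, hgz, h2.symm⟩

/-- αβ agrees with β and βα agrees with α modulo the center, while α and β commute. -/
theorem α_rel_β (x : Q) : CenRel (α x) (β x) := by
  refine (H.β_α_rel x).symm.trans ?_
  rw [← H.α_β]
  exact H.α_β_rel x

/-- Elements fixed by `α` modulo the center (idempotents modulo the center). -/
def Idem (_ : IsFLoop f g α β) : Set Q := {t | CenRel (α t) t}

/-- Elements annihilated by `α` modulo the center. -/
def Ker (_ : IsFLoop f g α β) : Set Q := {n | α n ∈ center Q}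

theorem α_mem_Idem (x : Q) : α x ∈ H.Idem := H.α_α x

theorem add_mem_Idem {s t : Q} (hs : s ∈ H.Idem) (ht : t ∈ H.Idem) : s + t ∈ H.Idem := by
  show CenRel _ _
  rw [H.α_add]
  exact CenRel.add hs ht

theorem lneg_mem_Idem {s : Q} (hs : s ∈ H.Idem) : lneg s ∈ H.Idem := by
  show CenRel _ _
  rw [additive_lneg H.α_add]
  exact CenRel.lneg hs

theorem f_mem_Idem {s : Q} : f s ∈ H.Idem ↔ s ∈ H.Idem := by
  show CenRel _ _ ↔ CenRel _ _
  rw [← H.f_α]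
  exact ⟨CenRel.of_map H.f_add H.f_bij, CenRel.map H.f_add H.f_bij⟩

theorem g_mem_Idem {s : Q} : g s ∈ H.Idem ↔ s ∈ H.Idem := by
  show CenRel _ _ ↔ CenRel _ _
  rw [← H.g_α]
  exact ⟨CenRel.of_map H.g_add H.g_bij, CenRel.map H.g_add H.g_bij⟩

theorem center_subset_Idem {z : Q} (hz : z ∈ center Q) : z ∈ H.Idem :=
  cenRel_of_mem (H.α_mem_center hz) hz

/-- On idempotents modulo the center, `α` and `β` are the same central translate. -/
theorem exists_eps {u : Q} (hu : u ∈ H.Idem) :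
    ∃ ε ∈ center Q, g (α u) = g u + ε ∧ f (β u) = f u + ε := by
  obtain ⟨z, hz, h⟩ := CenRel.map H.g_add H.g_bij hu
  obtain ⟨w, hw, h'⟩ := CenRel.map H.f_add H.f_bij ((H.α_rel_β u).symm.trans hu)
  have h1 := H.f_add_α u
  have h2 := H.β_add_g u
  rw [h, cen_add_right hz] at h1
  rw [h', cen_add_left hw] at h2
  have : z = w := loop_add_left_cancel (h1.trans h2.symm)
  exact ⟨z, hz, h, this ▸ h'⟩

/-! #### The kernel is nuclear and commutes with the idempotents -/

/-- For n in the kernel, g(αn) is central, so the left law for n only moves a central element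
around. -/
theorem ker_left {n : Q} (hn : n ∈ H.Ker) (y z : Q) : (n + y) + z = n + (y + z) := by
  have hc : g (α n) ∈ center Q := (additive_mem_center_iff H.g_add H.g_bij).2 hn
  have h1 : n + y = (f n + y) + g (α n) := by simpa using H.left_law n y 0
  rw [H.left_law, h1, nuc_mid hc.1]

theorem ker_right {n : Q} (hn : n ∈ H.Ker) (y z : Q) : (y + z) + n = y + (z + n) := by
  have hc : f (β n) ∈ center Q := (additive_mem_center_iff H.f_add H.f_bij).2
    ((H.α_rel_β n).symm.mem hn)
  have h1 : z + n = f (β n) + (z + g n) := by simpa using H.right_law n 0 z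
  rw [H.right_law, h1, nuc_mid hc.1]

theorem ker_comm {n : Q} (hn : n ∈ H.Ker) {i : Q} (hi : i ∈ H.Idem) : n + i = i + n := by
  have key : ∀ z, n + f (β z) = f (β z) + n := fun z => by
    have h : ∀ y, y + z = f (β z) + (y + g z) := fun y => by simpa using H.right_law z 0 y
    -- With r + g z = 0, the law y + z = f(βz) + (y + g z) at y = n + r evaluates to f(βz) + n, and
    -- at y = r to f(βz).
    have h1 := h (n + rsub 0 (g z))
    rwa [H.ker_left hn, H.ker_left hn, rsub_add, h (rsub 0 (g z)), rsub_add, loop_add_zero,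
      loop_add_zero] at h1
  obtain ⟨j, rfl⟩ := H.f_bij.2 i
  obtain ⟨w, hw, h⟩ := CenRel.map H.f_add H.f_bij
    ((H.α_rel_β j).symm.trans (H.f_mem_Idem.1 hi))
  have h1 := key j
  rw [h, cen_add_right hw, cen_add_left hw] at h1
  exact loop_add_right_cancel h1

/-- Splitting for an endomorphism idempotent modulo the center: subtract αx from x on the right. -/
theorem exists_ker_add_idem (x : Q) : ∃ n ∈ H.Ker, ∃ i ∈ H.Idem, x = n + i := by
  refine ⟨rsub x (α x), ?_, α x, H.α_mem_Idem x, (rsub_add x (α x)).symm⟩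
  obtain ⟨z, hz, h⟩ := H.α_α x
  have h1 : α (rsub x (α x)) + α (α x) = α x := by rw [← H.α_add, rsub_add]
  rw [h, cen_add_right hz, ← cen_add_left hz] at h1
  have h2 := loop_add_right_cancel (h1.trans (loop_zero_add _).symm)
  rw [← cen_comm hz] at h2
  show α _ ∈ center Q
  rw [eq_lneg h2]
  exact lneg_mem_center hz

theorem ker_mem_nucleus {n : Q} (hn : n ∈ H.Ker) : n ∈ nucleus Q := by
  intro p q
  refine ⟨H.ker_left hn p q, ?_, H.ker_right hn p q⟩
  obtain ⟨m, hm, i, hi, rfl⟩ := H.exists_ker_add_idem p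
  obtain ⟨r, hr, j, hj, rfl⟩ := H.exists_ker_add_idem q
  rw [H.ker_comm hr hj, ← H.ker_right hr n j, ← H.ker_right hr, ← H.ker_right hr, H.ker_left hm,
    H.ker_left hm, H.ker_left hm, ← H.ker_comm hn hi, H.ker_left hn, H.ker_comm hn hj,
    ← H.ker_right hn, H.ker_left hm i j, H.ker_left hm (i + j), H.ker_left hm,
    ← H.ker_comm hn (H.add_mem_Idem hi hj)]

theorem ker_add_idem {n m i : Q} (hn : n ∈ H.Ker) (hm : m ∈ H.Ker) (hi : i ∈ H.Idem) (j : Q) :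
    (n + i) + (m + j) = (n + m) + (i + j) := by
  rw [H.ker_left hn, H.ker_left hn, ← nuc_mid (H.ker_mem_nucleus hm), ← H.ker_comm hm hi,
    H.ker_left hm]

/-! #### The idempotents commute -/

/-- Conjugation by `u`. -/
noncomputable def conj (u x : Q) : Q := lsub u (x + u)

omit H in
theorem add_conj (u x : Q) : u + conj u x = x + u := add_lsub _ _

omit H in
theorem eq_conj {u x y : Q} (h : u + y = x + u) : conj u x = y := (eq_lsub h).symm

omit H in
theorem conj_zero (u : Q) : conj u 0 = 0 := eq_conj (by simp)

omit H in
theorem conj_self (u : Q) : conj u u = u := eq_conj rfl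

/-- The left law distributes u over a sum from the left, the right law from the right. On
idempotents both produce the translations f u and g u with the same central error ε, so conjugation
splits over the sum. -/
theorem conj_add' {u : Q} (hu : u ∈ H.Idem) (x y : Q) :
    conj u (x + y) = conj (f u) x + conj (g u) y := by
  obtain ⟨ε, hε, h1, h2⟩ := H.exists_eps hu
  apply eq_conj
  rw [H.left_law u, add_conj, H.right_law u, h1, h2, cen_add_left hε, add_conj,
    cen_add_right hε, cen_add_right hε, cen_add_left hε]

theorem conj_f {u : Q} (hu : u ∈ H.Idem) (x : Q) : conj (f u) x = conj u x := by
  have := H.conj_add' hu x 0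
  rwa [loop_add_zero, conj_zero, loop_add_zero, eq_comm] at this

theorem conj_g {u : Q} (hu : u ∈ H.Idem) (x : Q) : conj (g u) x = conj u x := by
  have := H.conj_add' hu 0 x
  rwa [loop_zero_add, conj_zero, loop_zero_add, eq_comm] at this

theorem conj_add {u : Q} (hu : u ∈ H.Idem) (x y : Q) : conj u (x + y) = conj u x + conj u y := by
  rw [H.conj_add' hu, H.conj_f hu, H.conj_g hu]

theorem conj_conj_add {u v : Q} (hu : u ∈ H.Idem) (hv : v ∈ H.Idem) :
    conj v (conj u (u + v)) = u + v := by
  rw [H.conj_add hu, conj_self, add_conj, H.conj_add hv, conj_self, add_conj]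

/-- Conjugating by u and then by v fixes u + v, and also f u + v because f u conjugates as u does.
Since u + v = (f u + v) + g(αu), it fixes g(αu), which conjugation by u already fixes; hence v
commutes with g(αu). Modulo the center, these elements exhaust the idempotents. -/
theorem idem_comm {i v : Q} (hi : i ∈ H.Idem) (hv : v ∈ H.Idem) : v + i = i + v := by
  have key : ∀ u ∈ H.Idem, v + g (α u) = g (α u) + v := fun u hu => by
    have h0 : (f u + v) + g (α u) = u + v := by simpa using (H.left_law u v 0).symm
    have h1 := H.conj_conj_add hu hv
    have h2 := H.conj_conj_add (H.f_mem_Idem.2 hu) hv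
    rw [H.conj_f hu] at h2
    have h3 := h1
    rw [← h0, H.conj_add hu, H.conj_add hv, h2] at h3
    have h4 := loop_add_left_cancel h3
    have h5 : conj u (g (α u)) = g (α u) := by
      have := congrArg (conj u) (H.f_add_α u)
      rw [H.conj_add hu, ← H.conj_f hu (f u), conj_self, conj_self] at this
      exact loop_add_left_cancel (this.trans (H.f_add_α u).symm)
    rw [h5] at h4
    conv_lhs => rw [← h4]
    rw [add_conj]
  obtain ⟨j, rfl⟩ := H.g_bij.2 i
  obtain ⟨ε, hε, h1, -⟩ := H.exists_eps (H.g_mem_Idem.1 hi)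
  have := key j (H.g_mem_Idem.1 hi)
  rw [h1, cen_add_right hε, cen_add_left hε] at this
  exact loop_add_right_cancel this

/-! #### Inverse property -/

/-- With w = f u + y, the right law for -u cancels the f-parts and the left law for u cancels the
g-parts. The central errors that remain are opposite. -/
theorem idem_add_add_lneg {u : Q} (hu : u ∈ H.Idem) (w : Q) : u + (w + lneg u) = w := by
  obtain ⟨ε, hε, h1, -⟩ := H.exists_eps hu
  obtain ⟨ε', hε', h1', h2'⟩ := H.exists_eps (H.lneg_mem_Idem hu)
  have hεε' : ε' = lneg ε := by
    rw [additive_lneg H.α_add, additive_lneg H.g_add, h1] at h1'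
    rw [additive_lneg H.g_add] at h1'
    apply loop_add_left_cancel (a := lneg (g u))
    rw [← h1']
    refine (eq_lneg ?_).symm
    rw [cen_add_left hε, cen_add_right (lneg_mem_center hε), add_lneg, loop_zero_add,
      lneg_add_of_nuc hε.1]
  obtain ⟨y, rfl⟩ : ∃ y, f u + y = w := ⟨_, add_lsub _ _⟩
  have h3 : u + (y + g (lneg u)) = (f u + y) + ε := by
    rw [H.left_law u, h1, cen_add_left hε, ← H.g_add, add_lneg, additive_zero H.g_add,
      loop_zero_add]
  have h4 : (f u + y) + lneg u = ε' + (y + g (lneg u)) := by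
    rw [H.right_law, h2', cen_add_right hε', ← H.f_add, add_lneg, additive_zero H.f_add,
      loop_zero_add]
  rw [h4, cen_mid hε', h3, hεε', cen_comm (lneg_mem_center hε), nuc_mid hε.1, add_lneg,
    loop_add_zero]

theorem idem_add_add_lneg' {u : Q} (hu : u ∈ H.Idem) (w : Q) : (u + w) + lneg u = w :=
  loop_add_left_cancel (H.idem_add_add_lneg hu _)

theorem idem_lneg_lneg {u : Q} (hu : u ∈ H.Idem) : lneg (lneg u) = u := by
  refine (eq_lneg ?_).symm
  rw [H.idem_comm hu (H.lneg_mem_Idem hu), add_lneg]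

/-- Three uses of the inverse property: (q + a) - q = a, then a - (q + a) = -q, then -q - a = -(q +
a). -/
theorem idem_lneg_add {q a : Q} (hq : q ∈ H.Idem) (ha : a ∈ H.Idem) :
    lneg (q + a) = lneg q + lneg a := by
  have h1 := H.idem_add_add_lneg' hq a
  have h2 := H.idem_add_add_lneg' (H.add_mem_Idem hq ha) (lneg q)
  rw [h1] at h2
  have h3 := H.idem_add_add_lneg' ha (lneg (q + a))
  rw [h2] at h3
  exact h3.symm

/-! #### Extension from idempotents to the whole loop -/

/-- The kernel parts are nuclear and commute with idempotents, so only associativity on the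
idempotent parts has to be tested. -/
theorem mem_center_of_idem {c : Q} (hc : c ∈ H.Idem)
    (h : ∀ i ∈ H.Idem, ∀ j ∈ H.Idem, (c + i) + j = c + (i + j)) : c ∈ center Q := by
  have hcn : ∀ n ∈ H.Ker, ∀ i, c + (n + i) = n + (c + i) := fun n hn i => by
    rw [← nuc_mid (H.ker_mem_nucleus hn), ← H.ker_comm hn hc, H.ker_left hn]
  refine mem_center_of (fun x y => ?_) (fun x => ?_) (fun x y => ?_) <;>
    obtain ⟨n, hn, i, hi, rfl⟩ := H.exists_ker_add_idem x
  · obtain ⟨m, hm, j, hj, rfl⟩ := H.exists_ker_add_idem y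
    rw [hcn n hn, H.ker_add_idem hn hm (H.add_mem_Idem hc hi), H.ker_add_idem hn hm hi, h i hi j hj,
      H.ker_left hn, H.ker_left hn, hcn n hn, hcn m hm]
  · rw [hcn n hn, H.ker_left hn, H.idem_comm hi hc]
  · obtain ⟨m, hm, j, hj, rfl⟩ := H.exists_ker_add_idem y
    rw [hcn m hm, H.ker_add_idem hn hm hi, H.ker_add_idem hn hm hi, H.ker_left hn, H.ker_left hn,
      hcn n hn, hcn m hm, H.idem_comm (H.add_mem_Idem hc hj) hi, h j hj i hi, H.idem_comm hj hi]

/-- An autotopism of the commutative inverse property loop of idempotents given by left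
translations produces a central element. -/
theorem add_mem_center_of_autotopism {p q u : Q} (hp : p ∈ H.Idem) (hq : q ∈ H.Idem)
    (hu : u ∈ H.Idem)
    (h : ∀ x ∈ H.Idem, ∀ y ∈ H.Idem, (p + x) + (q + y) = u + (x + y)) : p + u ∈ center Q := by
  have comm := fun {i v : Q} (hi : i ∈ H.Idem) (hv : v ∈ H.Idem) => H.idem_comm hi hv
  have add := fun {i v : Q} (hi : i ∈ H.Idem) (hv : v ∈ H.Idem) => H.add_mem_Idem hi hv
  have neg := fun {i : Q} (hi : i ∈ H.Idem) => H.lneg_mem_Idem hi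
  -- The inverse property permutes the components of an autotopism: (L_p, L_q, L_u) becomes (L_u,
  -- L_{-q}, L_p).
  have rot : ∀ s ∈ H.Idem, ∀ x ∈ H.Idem, (u + s) + (lneg q + x) = p + (s + x) := by
    intro s hs x hx
    have h1 := h (s + x) (add hs hx) (lneg x) (neg hx)
    rw [comm hx hs, H.idem_add_add_lneg' hx, comm (add hq (neg hx))
      (add hp (add hx hs))] at h1
    have h2 := H.idem_add_add_lneg' (add hq (neg hx)) (p + (x + s))
    rw [h1, H.idem_lneg_add hq (neg hx), H.idem_lneg_lneg hx] at h2
    rw [h2, comm hx hs]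
  -- The product of the two autotopisms is (L_p L_u, 1, L_u L_p).
  have comp : ∀ s ∈ H.Idem, ∀ x ∈ H.Idem, (p + (u + s)) + x = u + (p + (s + x)) := by
    intro s hs x hx
    have h1 := h (u + s) (add hu hs) (lneg q + x) (add (neg hq) hx)
    rwa [rot s hs x hx, comm hx (neg hq), H.idem_add_add_lneg hq] at h1
  have hz : (0 : Q) ∈ H.Idem := H.center_subset_Idem zero_mem_center
  refine H.mem_center_of_idem (add hp hu) fun i hi j hj => ?_
  have h1 : ∀ x ∈ H.Idem, (p + u) + x = u + (p + x) := fun x hx => by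
    simpa using comp 0 hz x hx
  have h2 : ∀ s ∈ H.Idem, p + (u + s) = u + (p + s) := fun s hs => by
    simpa using comp s hs 0 hz
  rw [h1 i hi, ← h2 i hi, comp i hi j hj, h1 _ (add hi hj)]

/-- The left law is the autotopism (L_{f u}, L_{g(αu)}, L_u), to which the previous criterion
applies. Thus f inverts idempotents modulo the center. -/
theorem add_f_mem_center {u : Q} (hu : u ∈ H.Idem) : u + f u ∈ center Q := by
  rw [H.idem_comm (H.f_mem_Idem.2 hu) hu]
  exact H.add_mem_center_of_autotopism (H.f_mem_Idem.2 hu) (H.g_mem_Idem.2 (H.α_mem_Idem u)) hu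
    fun x _ y _ => (H.left_law u x y).symm

theorem add_g_α_mem_center {u : Q} (hu : u ∈ H.Idem) : u + g (α u) ∈ center Q := by
  have hg := H.g_mem_Idem.2 (H.α_mem_Idem u)
  have hf := H.f_mem_Idem.2 hu
  rw [H.idem_comm hg hu]
  refine H.add_mem_center_of_autotopism hg hf hu fun x hx y hy => ?_
  rw [H.idem_comm (H.add_mem_Idem hf hy) (H.add_mem_Idem hg hx), ← H.left_law, H.idem_comm hx hy]

theorem add_g_mem_center {u : Q} (hu : u ∈ H.Idem) : u + g u ∈ center Q := by
  obtain ⟨ε, hε, h1, -⟩ := H.exists_eps hu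
  have h := H.add_g_α_mem_center hu
  rw [h1, cen_add_right hε] at h
  exact CenRel.mem (CenRel.symm ⟨ε, hε, rfl⟩) h

/-- In the left law for -u, both f(-u) and g(α(-u)) equal u up to a central summand. At x = y = 0
the law identifies -u with 2u up to the same summands, and cancelling them leaves the Moufang
identity. -/
theorem idem_mem_moufangCenter {u : Q} (hu : u ∈ H.Idem) : u ∈ moufangCenter Q := by
  have hv := H.lneg_mem_Idem hu
  have key : ∀ w, lneg u + w ∈ center Q → ∃ z ∈ center Q, w = z + u := fun w hw => by
    have h := H.idem_add_add_lneg' hv w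
    rw [H.idem_lneg_lneg hu] at h
    exact ⟨_, hw, h.symm⟩
  obtain ⟨z, hz, h1⟩ := key _ (H.add_f_mem_center hv)
  obtain ⟨z', hz', h2⟩ := key _ (H.add_g_α_mem_center hv)
  have h3 : ∀ x y, lneg u + (x + y) = (z + z') + ((u + x) + (u + y)) := fun x y => by
    rw [H.left_law, h1, h2, cen_left hz, cen_left hz', cen_left hz, cen_mid hz', cen_left hz]
  have h4 : lneg u = (z + z') + (u + u) := by simpa using h3 0 0
  intro x y
  have h5 := h3 x y
  rw [h4, cen_left (add_mem_center hz hz')] at h5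
  exact loop_add_left_cancel h5

theorem ker_rel_f {n : Q} (hn : n ∈ H.Ker) : CenRel (f n) n :=
  CenRel.symm ⟨_, (additive_mem_center_iff H.g_add H.g_bij).2 hn, (H.f_add_α n).symm⟩

theorem ker_rel_g {n : Q} (hn : n ∈ H.Ker) : CenRel (g n) n := by
  have h : f (β n) ∈ center Q :=
    (additive_mem_center_iff H.f_add H.f_bij).2 ((H.α_rel_β n).symm.mem hn)
  exact CenRel.symm ⟨_, h, by rw [← cen_comm h, H.β_add_g]⟩

theorem exists_nuc_add_mou (x : Q) : ∃ n ∈ nucleus Q, ∃ k ∈ moufangCenter Q, x = n + k := by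
  obtain ⟨n, hn, i, hi, rfl⟩ := H.exists_ker_add_idem x
  exact ⟨n, H.ker_mem_nucleus hn, i, H.idem_mem_moufangCenter hi, rfl⟩

theorem exists_of_mem_nucleus {n : Q} (hn : n ∈ nucleus Q) :
    ∃ m ∈ H.Ker, ∃ z ∈ center Q, n = m + z := by
  obtain ⟨m, hm, i, hi, rfl⟩ := H.exists_ker_add_idem n
  have hm' := H.ker_mem_nucleus hm
  refine ⟨m, hm, i, ⟨?_, H.idem_mem_moufangCenter hi⟩, rfl⟩
  rw [← lneg_add_cancel_of_nuc hm' i]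
  exact add_mem_nucleus (lneg_mem_nucleus hm') hn

theorem exists_of_mem_moufangCenter {k : Q} (hk : k ∈ moufangCenter Q) :
    ∃ i ∈ H.Idem, ∃ z ∈ center Q, k = z + i := by
  obtain ⟨m, hm, i, hi, rfl⟩ := H.exists_ker_add_idem k
  have hi' := H.idem_mem_moufangCenter hi
  refine ⟨i, hi, m, ⟨H.ker_mem_nucleus hm, ?_⟩, rfl⟩
  rw [← mou_add_add_lneg_cancel hi' m]
  exact add_mem_moufangCenter hk (lneg_mem_moufangCenter hi')

end IsFLoop

/-- An automorphism of a loop that is the identity on the nucleus and the inversion on the Moufang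
center, both modulo the center. -/
structure IsNegAut {Q : Type u} [AddLoop Q] (f : Q → Q) : Prop where
  map_add : ∀ x y, f (x + y) = f x + f y
  bij : Function.Bijective f
  nuc : ∀ n ∈ nucleus Q, CenRel (f n) n
  mou : ∀ k ∈ moufangCenter Q, k + f k ∈ center Q

namespace IsFLoop

variable {Q : Type u} [AddLoop Q] {f g α β : Q → Q} (H : IsFLoop f g α β)
include H

theorem isNegAut_of {h : Q → Q} (h_add : ∀ x y, h (x + y) = h x + h y)
    (h_bij : Function.Bijective h) (h_ker : ∀ n ∈ H.Ker, CenRel (h n) n)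
    (h_idem : ∀ i ∈ H.Idem, i + h i ∈ center Q) : IsNegAut h where
  map_add := h_add
  bij := h_bij
  nuc n hn := by
    obtain ⟨m, hm, z, hz, rfl⟩ := H.exists_of_mem_nucleus hn
    rw [h_add]
    exact (h_ker m hm).add (cenRel_of_mem ((additive_mem_center_iff h_add h_bij).2 hz) hz)
  mou k hk := by
    obtain ⟨i, hi, z, hz, rfl⟩ := H.exists_of_mem_moufangCenter hk
    have hz' := (additive_mem_center_iff h_add h_bij).2 hz
    rw [h_add, cen_left hz, cen_mid hz']
    exact add_mem_center hz (add_mem_center hz' (h_idem i hi))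

theorem isNegAut_f : IsNegAut f :=
  H.isNegAut_of H.f_add H.f_bij (fun _ => H.ker_rel_f) fun _ => H.add_f_mem_center

theorem isNegAut_g : IsNegAut g :=
  H.isNegAut_of H.g_add H.g_bij (fun _ => H.ker_rel_g) fun _ => H.add_g_mem_center

end IsFLoop

/-! ### Quasigroups: translations and autotopisms -/

section QuasigroupBasics

variable {Q : Type u} [Quasigroup Q]

theorem qmul_left_cancel {a x y : Q} (h : a * x = a * y) : x = y :=
  (Quasigroup.existsUnique_mul_left a (a * y)).unique h rfl

theorem qmul_right_cancel {a x y : Q} (h : x * a = y * a) : x = y :=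
  (Quasigroup.existsUnique_mul_right a (y * a)).unique h rfl

theorem eq_ldiv {a b x : Q} (h : a * x = b) : x = ldiv a b :=
  qmul_left_cancel (h.trans (mul_ldiv a b).symm)

theorem eq_rdiv {a b x : Q} (h : x * a = b) : x = rdiv b a :=
  qmul_right_cancel (h.trans (rdiv_mul b a).symm)

theorem mul_alpha (x : Q) : x * alpha x = x := mul_ldiv x x

theorem beta_mul (x : Q) : beta x * x = x := rdiv_mul x x

theorem eq_alpha {x y : Q} (h : x * y = x) : y = alpha x := eq_ldiv h

theorem eq_beta {x y : Q} (h : y * x = x) : y = beta x := eq_rdiv h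

/-- Left translation. -/
noncomputable def lmul (x : Q) : Equiv.Perm Q where
  toFun y := x * y
  invFun y := ldiv x y
  left_inv _ := (eq_ldiv rfl).symm
  right_inv y := mul_ldiv x y

/-- Right translation. -/
noncomputable def rmul (x : Q) : Equiv.Perm Q where
  toFun y := y * x
  invFun y := rdiv y x
  left_inv _ := (eq_rdiv rfl).symm
  right_inv y := rdiv_mul y x

theorem lmul_apply (x y : Q) : lmul x y = x * y := rfl

theorem rmul_apply (x y : Q) : rmul x y = y * x := rfl

variable (Q) in
/-- The group of autotopisms: triples `(A, B, C)` with `C (x * y) = A x * B y`. -/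
def autotopism : Subgroup (Equiv.Perm Q × Equiv.Perm Q × Equiv.Perm Q) where
  carrier := {T | ∀ x y, T.2.2 (x * y) = T.1 x * T.2.1 y}
  mul_mem' {S T} hS hT x y := by
    show S.2.2 (T.2.2 (x * y)) = S.1 (T.1 x) * S.2.1 (T.2.1 y)
    rw [hT, hS]
  one_mem' _ _ := rfl
  inv_mem' {S} hS x y := by
    show S.2.2.symm (x * y) = S.1.symm x * S.2.1.symm y
    rw [Equiv.symm_apply_eq, hS, Equiv.apply_symm_apply, Equiv.apply_symm_apply]

/-- A permutation that is a translation by a central element (of any loop isotope). -/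
def IsCentral (ζ : Equiv.Perm Q) : Prop :=
  ∃ ζ₁ ζ₂ : Equiv.Perm Q, (ζ₁, 1, ζ) ∈ autotopism Q ∧ (1, ζ₂, ζ) ∈ autotopism Q

variable (Q) in
/-- Congruence modulo central permutations. -/
def CentrallyRelated (x y : Q) : Prop := ∃ ζ : Equiv.Perm Q, IsCentral ζ ∧ x = ζ y

end QuasigroupBasics

/-! ### Central permutations from commutators of translations in an F-quasigroup. -/

section FQuasigroupBasics

variable {Q : Type u} [FQuasigroup Q]

theorem alpha_mul (x y : Q) : alpha (x * y) = alpha x * alpha y := by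
  refine (eq_alpha ?_).symm
  rw [← FQuasigroup.left_F, mul_alpha]

theorem beta_mul' (x y : Q) : beta (x * y) = beta x * beta y := by
  refine (eq_beta ?_).symm
  rw [← FQuasigroup.right_F, beta_mul]

theorem alpha_beta (x : Q) : alpha (beta x) = beta (alpha x) := by
  refine eq_beta ?_
  rw [← alpha_mul, beta_mul]

theorem lmul_mem (x : Q) : (lmul x, lmul (alpha x), lmul x) ∈ autotopism Q :=
  fun y z => FQuasigroup.left_F x y z

theorem rmul_mem (x : Q) : (rmul (beta x), rmul x, rmul x) ∈ autotopism Q :=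
  fun z y => FQuasigroup.right_F x y z

theorem rmul_mul_lmul (x y : Q) : rmul y * lmul x = lmul (x * beta y) * rmul y :=
  Equiv.ext fun z => FQuasigroup.right_F y z x

theorem comm_eq_lmul (x y : Q) :
    lmul x * rmul y * (lmul x)⁻¹ * (rmul y)⁻¹ = lmul x * (lmul (x * beta y))⁻¹ := by
  have h : (lmul (x * beta y))⁻¹ = rmul y * (lmul x)⁻¹ * (rmul y)⁻¹ := by
    rw [eq_mul_inv_iff_mul_eq, eq_mul_inv_iff_mul_eq, mul_assoc, inv_mul_eq_iff_eq_mul,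
      rmul_mul_lmul]
  rw [h]
  simp only [mul_assoc]

theorem IsCentral.conj {ζ A B C : Equiv.Perm Q} (h : IsCentral ζ) (hT : (A, B, C) ∈ autotopism Q) :
    IsCentral (C⁻¹ * ζ * C) := by
  obtain ⟨ζ₁, ζ₂, h₁, h₂⟩ := h
  have h3 := mul_mem (mul_mem (inv_mem hT) h₁) hT
  have h4 := mul_mem (mul_mem (inv_mem hT) h₂) hT
  simp only [Prod.mk_mul_mk, Prod.inv_mk, mul_one, inv_mul_cancel] at h3 h4
  exact ⟨_, _, h3, h4⟩

/-- The permutations `L_{x β(t)} L_{x t}⁻¹` with `t = β y` are central. -/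
theorem isCentral_lmul (x y : Q) :
    IsCentral (lmul (x * beta (beta y)) * (lmul (x * beta y))⁻¹) := by
  set V := lmul (x * beta (beta y)) * (lmul (x * beta y))⁻¹ with hV
  -- The commutator of the autotopisms of L_x and R_y has outer components L_x L_{xββy}⁻¹ and L_x
  -- L_{xβy}⁻¹. Comparison with the autotopism of L_x L_{xβy}⁻¹ makes the third component trivial.
  obtain ⟨S, hS⟩ : ∃ S, (V, S, 1) ∈ autotopism Q := by
    have hA := lmul_mem x
    have hB := rmul_mem y
    have h1 := mul_mem (mul_mem (mul_mem hA hB) (inv_mem hA)) (inv_mem hB)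
    have h2 := mul_mem hA (inv_mem (lmul_mem (x * beta y)))
    have h3 := mul_mem (inv_mem h1) h2
    simp only [Prod.mk_mul_mk, Prod.inv_mk, comm_eq_lmul] at h3
    have e : (lmul x * (lmul (x * beta (beta y)))⁻¹)⁻¹ * (lmul x * (lmul (x * beta y))⁻¹) = V := by
      rw [hV]
      group
    rw [e, inv_mul_cancel] at h3
    exact ⟨_, h3⟩
  -- As a quotient of two left translations, V is both the first and the third component of an
  -- autotopism; dividing by (V, S, 1) trivializes the first.
  obtain ⟨W, hW⟩ : ∃ W, (1, W, V) ∈ autotopism Q := by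
    have h := mul_mem (inv_mem hS)
      (mul_mem (lmul_mem (x * beta (beta y))) (inv_mem (lmul_mem (x * beta y))))
    simp only [Prod.mk_mul_mk, Prod.inv_mk, ← hV, inv_mul_cancel, inv_one, one_mul] at h
    exact ⟨_, h⟩
  -- it suffices to treat the conjugate by a right translation
  set V' := rmul x * V * (rmul x)⁻¹ with hV'
  set p := x * beta (beta y) * beta x with hp
  set q := x * beta y * beta x with hq
  have hVpq : V' = lmul p * (lmul q)⁻¹ := by
    have e : ∀ t, lmul (t * beta x) = rmul x * lmul t * (rmul x)⁻¹ := fun t => by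
      rw [eq_mul_inv_iff_mul_eq, rmul_mul_lmul]
    rw [hp, hq, e, e, hV', hV]
    group
  have hV0 : ∀ w, V' (q * w) = p * w := fun w => by
    rw [hVpq]
    show lmul p ((lmul q).symm (lmul q w)) = _
    rw [Equiv.symm_apply_apply, lmul_apply]
  have hW' : (1, rmul x * W * (rmul x)⁻¹, V') ∈ autotopism Q := by
    have h := mul_mem (mul_mem (rmul_mem x) hW) (inv_mem (rmul_mem x))
    simpa only [Prod.mk_mul_mk, Prod.inv_mk, mul_one, mul_inv_cancel] using h
  set W' := rmul x * W * (rmul x)⁻¹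
  have hWv : ∀ u w, V' (u * w) = u * W' w := fun u w => hW' u w
  have hP : ∀ u, V' (u * x) = V u * x := fun u => by
    rw [hV']
    show rmul x (V ((rmul x).symm (rmul x u))) = _
    rw [Equiv.symm_apply_apply, rmul_apply]
  have hSv : ∀ u w, V u * w = u * S.symm w := fun u w => by
    have := hS u (S.symm w)
    simp only [Equiv.apply_symm_apply, Equiv.Perm.one_apply] at this
    exact this.symm
  have hVq : V q = p := by
    apply qmul_right_cancel (a := x)
    rw [← hP, hV0]
  -- The single value V q = p identifies the two second components, so V' is also a third component
  -- over (V, 1).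
  have hSW : ∀ w, S.symm w = W' w := fun w => by
    apply qmul_left_cancel (a := q)
    rw [← hSv, hVq, ← hWv, hV0]
  have hc : IsCentral V' := by
    refine ⟨V, W', ?_, hW'⟩
    intro u w
    show V' (u * w) = V u * w
    rw [hWv, hSv, hSW]
  convert hc.conj (rmul_mem x) using 1
  rw [hV']
  group

/-- From ζ(xy) = x ζ₂(y), the companion ζ₂ is the conjugate of ζ by a left translation. -/
theorem IsCentral.snd {ζ ζ₂ : Equiv.Perm Q} (h : IsCentral ζ) (h₂ : (1, ζ₂, ζ) ∈ autotopism Q) :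
    IsCentral ζ₂ := by
  rcases isEmpty_or_nonempty Q with hQ | ⟨⟨x⟩⟩
  · exact ⟨1, 1, fun x => isEmptyElim x, fun x => isEmptyElim x⟩
  · convert h.conj (lmul_mem x) using 1
    rw [mul_assoc, eq_inv_mul_iff_mul_eq]
    exact Equiv.ext fun y => (h₂ x y).symm

theorem IsCentral.fst {ζ ζ₁ : Equiv.Perm Q} (h : IsCentral ζ) (h₁ : (ζ₁, 1, ζ) ∈ autotopism Q) :
    IsCentral ζ₁ := by
  rcases isEmpty_or_nonempty Q with hQ | ⟨⟨x⟩⟩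
  · exact ⟨1, 1, fun x => isEmptyElim x, fun x => isEmptyElim x⟩
  · convert h.conj (rmul_mem x) using 1
    rw [mul_assoc, eq_inv_mul_iff_mul_eq]
    exact Equiv.ext fun y => (h₁ y x).symm

/-- `β ∘ β` and `β` agree modulo central permutations. -/
theorem beta_beta_rel (y : Q) : CentrallyRelated Q (beta (beta y)) (beta y) := by
  have hc := isCentral_lmul y y
  obtain ⟨ζ₁, -, h₁, -⟩ := id hc
  have hc₁ := hc.fst h₁
  obtain ⟨-, ζ₂, -, h₂⟩ := id hc₁
  refine ⟨ζ₂, hc₁.snd h₂, ?_⟩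
  -- V sends (y βy) y to (y ββy) y and acts through ζ₁ on the left factor.
  have e1 : ζ₁ (y * beta y) = y * beta (beta y) := by
    apply qmul_right_cancel (a := y)
    refine (h₁ (y * beta y) y).symm.trans ?_
    show lmul _ ((lmul _).symm (lmul (y * beta y) y)) = _
    rw [Equiv.symm_apply_apply, lmul_apply]
  exact qmul_left_cancel (e1.symm.trans (h₂ y (beta y)))

end FQuasigroupBasics

/-! ### The opposite quasigroup -/

section Opposite

open MulOpposite

instance {Q : Type u} [Quasigroup Q] : Quasigroup Qᵐᵒᵖ where
  existsUnique_mul_left a b := by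
    obtain ⟨x, hx, hu⟩ := Quasigroup.existsUnique_mul_right a.unop b.unop
    exact ⟨op x, congrArg op hx, fun y hy => unop_injective (hu _ (congrArg unop hy))⟩
  existsUnique_mul_right a b := by
    obtain ⟨x, hx, hu⟩ := Quasigroup.existsUnique_mul_left a.unop b.unop
    exact ⟨op x, congrArg op hx, fun y hy => unop_injective (hu _ (congrArg unop hy))⟩

theorem alpha_op {Q : Type u} [Quasigroup Q] (x : Q) : alpha (op x) = op (beta x) :=
  (eq_alpha (by rw [← op_mul, beta_mul])).symm

theorem beta_op {Q : Type u} [Quasigroup Q] (x : Q) : beta (op x) = op (alpha x) :=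
  (eq_beta (by rw [← op_mul, mul_alpha])).symm

instance {Q : Type u} [FQuasigroup Q] : FQuasigroup Qᵐᵒᵖ where
  left_F x y z := by
    obtain ⟨x, rfl⟩ := op_surjective x
    obtain ⟨y, rfl⟩ := op_surjective y
    obtain ⟨z, rfl⟩ := op_surjective z
    rw [alpha_op]
    exact congrArg op (FQuasigroup.right_F x y z)
  right_F x y z := by
    obtain ⟨x, rfl⟩ := op_surjective x
    obtain ⟨y, rfl⟩ := op_surjective y
    obtain ⟨z, rfl⟩ := op_surjective z
    rw [beta_op]
    exact congrArg op (FQuasigroup.left_F x y z)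

theorem IsCentral.unop {Q : Type u} [Quasigroup Q] {ζ : Equiv.Perm Qᵐᵒᵖ} (h : IsCentral ζ) :
    IsCentral ((opEquiv.trans ζ).trans opEquiv.symm : Equiv.Perm Q) := by
  obtain ⟨ζ₁, ζ₂, h₁, h₂⟩ := h
  exact ⟨(opEquiv.trans ζ₂).trans opEquiv.symm, (opEquiv.trans ζ₁).trans opEquiv.symm,
    fun x y => congrArg MulOpposite.unop (h₂ (op y) (op x)),
    fun x y => congrArg MulOpposite.unop (h₁ (op y) (op x))⟩

theorem CentrallyRelated.unop {Q : Type u} [Quasigroup Q] {x y : Q}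
    (h : CentrallyRelated Qᵐᵒᵖ (op x) (op y)) : CentrallyRelated Q x y := by
  obtain ⟨ζ, hζ, h⟩ := h
  exact ⟨_, hζ.unop, congrArg MulOpposite.unop h⟩

/-- `α ∘ α` and `α` agree modulo central permutations. -/
theorem alpha_alpha_rel {Q : Type u} [FQuasigroup Q] (y : Q) :
    CentrallyRelated Q (alpha (alpha y)) (alpha y) := by
  have h := beta_beta_rel (op y)
  rw [beta_op, beta_op] at h
  exact h.unop

end Opposite

/-! ### Twisting by a central permutation -/

/-- The quasigroup with multiplication `ζ (x * y)`. -/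
@[ext]
structure Twist {Q : Type u} [Quasigroup Q] (ζ : {ζ : Equiv.Perm Q // IsCentral ζ}) where
  /-- The underlying element. -/
  val : Q

namespace Twist

variable {Q : Type u}

instance [Quasigroup Q] (ζ : {ζ : Equiv.Perm Q // IsCentral ζ}) : Quasigroup (Twist ζ) where
  mul x y := ⟨ζ.1 (x.val * y.val)⟩
  existsUnique_mul_left a b := by
    refine ⟨⟨ldiv a.val (ζ.1.symm b.val)⟩, ?_, ?_⟩
    · ext
      show ζ.1 _ = _
      rw [mul_ldiv, Equiv.apply_symm_apply]
    · rintro y rfl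
      ext
      apply eq_ldiv
      exact (Equiv.symm_apply_apply _ _).symm
  existsUnique_mul_right a b := by
    refine ⟨⟨rdiv (ζ.1.symm b.val) a.val⟩, ?_, ?_⟩
    · ext
      show ζ.1 _ = _
      rw [rdiv_mul, Equiv.apply_symm_apply]
    · rintro y rfl
      ext
      apply eq_rdiv
      exact (Equiv.symm_apply_apply _ _).symm

theorem val_mul [Quasigroup Q] {ζ : {ζ : Equiv.Perm Q // IsCentral ζ}} (x y : Twist ζ) :
    (x * y).val = ζ.1 (x.val * y.val) := rfl

end Twist

namespace IsCentral

variable {Q : Type u} [FQuasigroup Q] {ζ : Equiv.Perm Q} (h : IsCentral ζ)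
include h

/-- Conjugating (1, ζ₂, ζ) by the autotopism of L_u turns its second component into ζ, since L_{αu}
intertwines ζ₂ and ζ. -/
theorem exists_lift_right [Nonempty Q] : ∃ η : Equiv.Perm Q, ∀ x y, η (x * y) = x * ζ y := by
  obtain ⟨u⟩ := ‹Nonempty Q›
  obtain ⟨-, ζ₂, -, h₂⟩ := h
  have h3 := mul_mem (mul_mem (lmul_mem u) h₂) (inv_mem (lmul_mem u))
  have e : lmul (alpha u) * ζ₂ * (lmul (alpha u))⁻¹ = ζ := by
    rw [mul_inv_eq_iff_eq_mul]
    exact Equiv.ext fun y => (h₂ (alpha u) y).symm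
  simp only [Prod.mk_mul_mk, Prod.inv_mk, mul_one, mul_inv_cancel, e] at h3
  exact ⟨_, h3⟩

theorem exists_lift_left [Nonempty Q] : ∃ ξ : Equiv.Perm Q, ∀ x y, ξ (x * y) = ζ x * y := by
  obtain ⟨u⟩ := ‹Nonempty Q›
  obtain ⟨ζ₁, -, h₁, -⟩ := h
  have h3 := mul_mem (mul_mem (rmul_mem u) h₁) (inv_mem (rmul_mem u))
  have e : rmul (beta u) * ζ₁ * (rmul (beta u))⁻¹ = ζ := by
    rw [mul_inv_eq_iff_eq_mul]
    exact Equiv.ext fun y => (h₁ y (beta u)).symm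
  simp only [Prod.mk_mul_mk, Prod.inv_mk, mul_one, mul_inv_cancel, e] at h3
  exact ⟨_, h3⟩

end IsCentral

namespace Twist

variable {Q : Type u} [FQuasigroup Q]

/-- All occurrences of ζ can be pulled outside by means of its lifts. The leftover shift is absorbed
by α and β: if w is the twisted αx, then ζ₂ w is the original αx. -/
noncomputable instance (ζ : {ζ : Equiv.Perm Q // IsCentral ζ}) : FQuasigroup (Twist ζ) where
  left_F := by
    rintro ⟨x⟩ ⟨y⟩ ⟨z⟩
    have : Nonempty Q := ⟨x⟩
    obtain ⟨ζ, hζ⟩ := ζ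
    obtain ⟨w, hw⟩ : ∃ w : Q, alpha (⟨x⟩ : Twist ⟨ζ, hζ⟩) = ⟨w⟩ := ⟨_, rfl⟩
    have hxw : ζ (x * w) = x := by
      have := congrArg Twist.val (mul_alpha (⟨x⟩ : Twist ⟨ζ, hζ⟩))
      rwa [hw] at this
    rw [hw]
    ext
    simp only [val_mul]
    congr 1
    obtain ⟨η, hη⟩ := hζ.exists_lift_right
    obtain ⟨ξ, hξ⟩ := hζ.exists_lift_left
    obtain ⟨-, ζ₂, -, h₂⟩ := hζ
    replace h₂ : ∀ a b, ζ (a * b) = a * ζ₂ b := h₂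
    rw [← hη, ← hη, ← hξ]
    congr 1
    -- Expanding by the F-law exposes the factor a * w, on which ζ can act through w alone; the
    -- F-law then folds the product back.
    have h3 : ∀ a, ξ (a * (w * z)) = a * (ζ₂ w * z) := fun a => by
      rw [FQuasigroup.left_F, hξ, h₂, ← FQuasigroup.left_F]
    have h4 : ζ₂ w = alpha x := eq_alpha (by rw [← h₂, hxw])
    rw [h3, h4, FQuasigroup.left_F]
  right_F := by
    rintro ⟨x⟩ ⟨y⟩ ⟨z⟩
    have : Nonempty Q := ⟨x⟩
    obtain ⟨ζ, hζ⟩ := ζ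
    obtain ⟨w, hw⟩ : ∃ w : Q, beta (⟨x⟩ : Twist ⟨ζ, hζ⟩) = ⟨w⟩ := ⟨_, rfl⟩
    have hxw : ζ (w * x) = x := by
      have := congrArg Twist.val (beta_mul (⟨x⟩ : Twist ⟨ζ, hζ⟩))
      rwa [hw] at this
    rw [hw]
    ext
    simp only [val_mul]
    congr 1
    obtain ⟨η, hη⟩ := hζ.exists_lift_right
    obtain ⟨ξ, hξ⟩ := hζ.exists_lift_left
    obtain ⟨ζ₁, -, h₁, -⟩ := hζ
    replace h₁ : ∀ a b, ζ (a * b) = ζ₁ a * b := h₁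
    rw [← hξ, ← hξ, ← hη]
    congr 1
    have h3 : ∀ a, η (z * w * a) = z * ζ₁ w * a := fun a => by
      rw [FQuasigroup.right_F, hη, h₁, ← FQuasigroup.right_F]
    have h4 : ζ₁ w = beta x := eq_beta (by rw [← h₁, hxw])
    rw [h3, h4, FQuasigroup.right_F]

/-- The underlying bijection. -/
def equiv (ζ : {ζ : Equiv.Perm Q // IsCentral ζ}) : Q ≃ Twist ζ where
  toFun x := ⟨x⟩
  invFun x := x.val
  left_inv _ := rfl
  right_inv _ := rfl

theorem equiv_mul (ζ : {ζ : Equiv.Perm Q // IsCentral ζ}) :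
    ∃ ω : Equiv.Perm (Twist ζ), IsCentral ω ∧
      ∀ x y, equiv ζ (x * y) = ω (equiv ζ x * equiv ζ y) := by
  obtain ⟨ζ, hζ⟩ := ζ
  set e := equiv ⟨ζ, hζ⟩
  obtain ⟨ζ₁, ζ₂, h₁, h₂⟩ := id hζ
  replace h₁ : ∀ a b, ζ (a * b) = ζ₁ a * b := h₁
  replace h₂ : ∀ a b, ζ (a * b) = a * ζ₂ b := h₂
  refine ⟨(e.symm.trans ζ.symm).trans e, ⟨(e.symm.trans ζ₁.symm).trans e,
    (e.symm.trans ζ₂.symm).trans e, ?_, ?_⟩, fun x y => ?_⟩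
  · rintro ⟨x⟩ ⟨y⟩
    ext
    show ζ.symm (ζ (x * y)) = ζ (ζ₁.symm x * y)
    rw [Equiv.symm_apply_apply, h₁, Equiv.apply_symm_apply]
  · rintro ⟨x⟩ ⟨y⟩
    ext
    show ζ.symm (ζ (x * y)) = ζ (x * ζ₂.symm y)
    rw [Equiv.symm_apply_apply, h₂, Equiv.apply_symm_apply]
  · ext
    show x * y = ζ.symm (ζ (x * y))
    rw [Equiv.symm_apply_apply]

end Twist

/-- Up to a central twist, every F-quasigroup has an idempotent. -/
theorem exists_idempotent_twist (Q : Type u) [FQuasigroup Q] [Nonempty Q] :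
    ∃ (P : Type u) (_ : FQuasigroup P) (t : P) (h : Q ≃ P) (ω : Equiv.Perm P),
      t * t = t ∧ IsCentral ω ∧ ∀ x y, h (x * y) = ω (h x * h y) := by
  obtain ⟨x⟩ := ‹Nonempty Q›
  set s := alpha x
  obtain ⟨ζ, hζ, h⟩ := alpha_alpha_rel x
  have hs : Nonempty Q := ⟨x⟩
  -- This twist makes s = αx idempotent: η(ss) = s ζ(s) = s α(s) = s.
  obtain ⟨η, hη⟩ := hζ.exists_lift_right
  have hηc : IsCentral η := by
    obtain ⟨-, ζ₂, -, h₂⟩ := id hζ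
    have e : (lmul x)⁻¹⁻¹ * ζ * (lmul x)⁻¹ = η := by
      rw [inv_inv, mul_inv_eq_iff_eq_mul]
      exact Equiv.ext fun y => (hη x y).symm
    rw [← e]
    exact hζ.conj (inv_mem (lmul_mem x))
  obtain ⟨ω, hω, hm⟩ := Twist.equiv_mul ⟨η, hηc⟩
  refine ⟨Twist ⟨η, hηc⟩, inferInstance, ⟨s⟩, Twist.equiv _, ω, ?_, hω, hm⟩
  ext
  show η (s * s) = s
  rw [hη, ← h, mul_alpha]

/-! ### The loop isotope at an idempotent -/

/-- The principal loop isotope of a quasigroup at an idempotent. -/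
@[ext]
structure IdemLoop {Q : Type u} [FQuasigroup Q] (t : {t : Q // t * t = t}) where
  /-- The underlying element. -/
  val : Q

namespace IdemLoop

variable {Q : Type u} [FQuasigroup Q] (t : {t : Q // t * t = t})

noncomputable instance : AddLoop (IdemLoop t) where
  add x y := ⟨rdiv x.val t.1 * ldiv t.1 y.val⟩
  zero := ⟨t.1⟩
  zero_add a := by
    ext
    show rdiv t.1 t.1 * ldiv t.1 a.val = a.val
    rw [← eq_rdiv t.2, mul_ldiv]
  add_zero a := by
    ext
    show rdiv a.val t.1 * ldiv t.1 t.1 = a.val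
    rw [← eq_ldiv t.2, rdiv_mul]
  existsUnique_add_left a b := by
    refine ⟨⟨t.1 * ldiv (rdiv a.val t.1) b.val⟩, ?_, ?_⟩
    · ext
      show rdiv a.val t.1 * ldiv t.1 (t.1 * _) = b.val
      rw [← eq_ldiv rfl, mul_ldiv]
    · rintro y rfl
      ext
      show y.val = t.1 * ldiv _ (rdiv a.val t.1 * ldiv t.1 y.val)
      rw [← eq_ldiv rfl, mul_ldiv]
  existsUnique_add_right a b := by
    refine ⟨⟨rdiv b.val (ldiv t.1 a.val) * t.1⟩, ?_, ?_⟩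
    · ext
      show rdiv (_ * t.1) t.1 * ldiv t.1 a.val = b.val
      rw [← eq_rdiv rfl, rdiv_mul]
    · rintro y rfl
      ext
      show y.val = rdiv (rdiv y.val t.1 * ldiv t.1 a.val) _ * t.1
      rw [← eq_rdiv rfl, rdiv_mul]

/-- The underlying bijection. -/
def equiv : Q ≃ IdemLoop t where
  toFun x := ⟨x⟩
  invFun x := x.val
  left_inv _ := rfl
  right_inv _ := rfl

/-- Right multiplication by the idempotent. -/
def f (x : IdemLoop t) : IdemLoop t := ⟨x.val * t.1⟩

/-- Left multiplication by the idempotent. -/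
def g (x : IdemLoop t) : IdemLoop t := ⟨t.1 * x.val⟩

theorem equiv_mul (x y : Q) : equiv t (x * y) = f t (equiv t x) + g t (equiv t y) := by
  ext
  show x * y = rdiv (x * t.1) t.1 * ldiv t.1 (t.1 * y)
  rw [← eq_rdiv rfl, ← eq_ldiv rfl]

theorem f_bij : Function.Bijective (f t) :=
  ⟨fun _ _ h => IdemLoop.ext (qmul_right_cancel (congrArg IdemLoop.val h)),
    fun y => ⟨⟨rdiv y.val t.1⟩, IdemLoop.ext (rdiv_mul _ _)⟩⟩

theorem g_bij : Function.Bijective (g t) :=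
  ⟨fun _ _ h => IdemLoop.ext (qmul_left_cancel (congrArg IdemLoop.val h)),
    fun y => ⟨⟨ldiv t.1 y.val⟩, IdemLoop.ext (mul_ldiv _ _)⟩⟩

/-- A multiplicative map that fixes the idempotent is additive. -/
theorem additive_of_mul {φ : Q → Q} (h : ∀ x y, φ (x * y) = φ x * φ y) (ht : φ t.1 = t.1)
    (x y : IdemLoop t) : (⟨φ (x + y).val⟩ : IdemLoop t) = ⟨φ x.val⟩ + ⟨φ y.val⟩ := by
  ext
  show φ (rdiv x.val t.1 * ldiv t.1 y.val) = rdiv (φ x.val) t.1 * ldiv t.1 (φ y.val)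
  rw [h]
  congr 1
  · apply eq_rdiv
    rw [← ht, ← h, ht, rdiv_mul]
  · apply eq_ldiv
    rw [← ht, ← h, ht, mul_ldiv]

/-- A central permutation commutes with all left and right translations of the loop, so it is
translation by its value at 0. -/
theorem mem_center_of_isCentral {ζ : Equiv.Perm Q} (h : IsCentral ζ) :
    ∃ c ∈ center (IdemLoop t), ∀ x, equiv t (ζ x) = equiv t x + c := by
  obtain ⟨ζ₁, ζ₂, h₁, h₂⟩ := h
  replace h₁ : ∀ a b, ζ (a * b) = ζ₁ a * b := h₁
  replace h₂ : ∀ a b, ζ (a * b) = a * ζ₂ b := h₂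
  have e1 : ∀ x y : IdemLoop t, equiv t (ζ (x + y).val) = x + equiv t (ζ y.val) := fun x y => by
    ext
    show ζ (rdiv x.val t.1 * ldiv t.1 y.val) = rdiv x.val t.1 * ldiv t.1 (ζ y.val)
    rw [h₂]
    congr 1
    apply eq_ldiv
    rw [← h₂, mul_ldiv]
  have e2 : ∀ x y : IdemLoop t, equiv t (ζ (x + y).val) = equiv t (ζ x.val) + y := fun x y => by
    ext
    show ζ (rdiv x.val t.1 * ldiv t.1 y.val) = rdiv (ζ x.val) t.1 * ldiv t.1 y.val
    rw [h₁]
    congr 1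
    apply eq_rdiv
    rw [← h₁, rdiv_mul]
  set c : IdemLoop t := equiv t (ζ (0 : IdemLoop t).val) with hc
  have e3 : ∀ x : IdemLoop t, equiv t (ζ x.val) = x + c := fun x => by
    rw [hc, ← e1, loop_add_zero]
  have e4 : ∀ x : IdemLoop t, equiv t (ζ x.val) = c + x := fun x => by
    rw [hc, ← e2, loop_zero_add]
  refine ⟨c, mem_center_of (fun x y => ?_) (fun x => ?_) (fun x y => ?_), fun x => e3 (equiv t x)⟩
  · rw [← e4, ← e4, e2]
  · rw [← e4, e3]
  · rw [← e4, ← e4, e1]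

theorem cenRel_of_centrallyRelated {x y : Q} (h : CentrallyRelated Q x y) :
    CenRel (equiv t x) (equiv t y) := by
  obtain ⟨ζ, hζ, rfl⟩ := h
  obtain ⟨c, hc, h⟩ := mem_center_of_isCentral t hζ
  exact ⟨c, hc, h y⟩

theorem isFLoop : IsFLoop (f t) (g t) (fun x => ⟨alpha x.val⟩) (fun x => ⟨beta x.val⟩) := by
  have hα : alpha t.1 = t.1 := (eq_alpha t.2).symm
  have hβ : beta t.1 = t.1 := (eq_beta t.2).symm
  have hf : ∀ x y : Q, x * y * t.1 = (x * t.1) * (y * t.1) := fun x y => by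
    rw [FQuasigroup.right_F, hβ]
  have hg : ∀ x y : Q, t.1 * (x * y) = (t.1 * x) * (t.1 * y) := fun x y => by
    rw [FQuasigroup.left_F, hα]
  have f_add : ∀ x y, f t (x + y) = f t x + f t y := additive_of_mul t (φ := (· * t.1)) hf t.2
  have g_add : ∀ x y, g t (x + y) = g t x + g t y := additive_of_mul t (φ := (t.1 * ·)) hg t.2
  have hm := equiv_mul t
  have hfg : ∀ x, f t (g t x) = g t (f t x) := fun x => IdemLoop.ext (by
    show t.1 * x.val * t.1 = t.1 * (x.val * t.1)
    rw [FQuasigroup.left_F, hα, t.2])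
  refine ⟨f_add, g_add, f_bij t, g_bij t, additive_of_mul t alpha_mul hα, fun x => ?_,
    fun x => ?_, fun x => ?_, fun x y z => ?_, fun x y z => ?_, fun x => ?_, fun x => ?_⟩
  · ext
    show alpha x.val * t.1 = alpha (x.val * t.1)
    rw [alpha_mul, hα]
  · ext
    show t.1 * alpha x.val = alpha (t.1 * x.val)
    rw [alpha_mul, hα]
  · ext
    exact alpha_beta x.val
  -- The arguments are written as values of f and g so that the loop law becomes the F-law of the
  -- quasigroup after both sides are expanded.
  · obtain ⟨x, rfl⟩ := (f_bij t).2 x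
    obtain ⟨y, rfl⟩ := ((g_bij t).comp (f_bij t)).2 y
    obtain ⟨z, rfl⟩ := ((g_bij t).comp (g_bij t)).2 z
    have h := congrArg (equiv t) (FQuasigroup.left_F x.val y.val z.val)
    simp only [hm, f_add, g_add] at h
    have e : (⟨alpha (f t x).val⟩ : IdemLoop t) = f t (equiv t (alpha x.val)) := by
      ext
      show alpha (x.val * t.1) = alpha x.val * t.1
      rw [alpha_mul, hα]
    rw [e]
    rw [hfg] at h
    exact h
  · obtain ⟨x, rfl⟩ := (g_bij t).2 x
    obtain ⟨y, rfl⟩ := ((f_bij t).comp (f_bij t)).2 y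
    obtain ⟨z, rfl⟩ := ((f_bij t).comp (g_bij t)).2 z
    have h := congrArg (equiv t) (FQuasigroup.right_F x.val z.val y.val)
    simp only [hm, f_add, g_add] at h
    have e : (⟨beta (g t x).val⟩ : IdemLoop t) = g t (equiv t (beta x.val)) := by
      ext
      show beta (t.1 * x.val) = t.1 * beta x.val
      rw [beta_mul', hβ]
    rw [e]
    rw [← hfg (equiv t z.val)] at h
    exact h
  · exact cenRel_of_centrallyRelated t (alpha_alpha_rel x.val)
  · exact cenRel_of_centrallyRelated t (beta_beta_rel x.val)

theorem f_g (x : IdemLoop t) : f t (g t x) = g t (f t x) := IdemLoop.ext (by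
  show t.1 * x.val * t.1 = t.1 * (x.val * t.1)
  rw [FQuasigroup.left_F, ← eq_alpha t.2, t.2])

end IdemLoop

/-! ### Arithmetic forms -/

/-- An F-quasigroup is given by `x * y = (f x + e) + g y` on an NK-loop, with `e` central. -/
theorem exists_central_form (Q : Type u) [FQuasigroup Q] [Nonempty Q] :
    ∃ (P : Type u) (_ : NKLoop P) (f g : P → P) (e : P) (h : Q ≃ P), IsNegAut f ∧ IsNegAut g ∧
      (∀ x, f (g x) = g (f x)) ∧ e ∈ nucleus P ∧ ∀ x y, h (x * y) = (f (h x) + e) + g (h y) := by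
  obtain ⟨P, _, t, h, ω, ht, hω, hm⟩ := exists_idempotent_twist Q
  have H := IdemLoop.isFLoop ⟨t, ht⟩
  obtain ⟨c, hc, hωc⟩ := IdemLoop.mem_center_of_isCentral ⟨t, ht⟩ hω
  refine ⟨IdemLoop ⟨t, ht⟩, { exists_nucleus_add_moufangCenter := H.exists_nuc_add_mou },
    IdemLoop.f _, IdemLoop.g _, c, h.trans (IdemLoop.equiv _), H.isNegAut_f, H.isNegAut_g,
    IdemLoop.f_g _, hc.1, fun x y => ?_⟩
  rw [Equiv.trans_apply, hm, hωc, IdemLoop.equiv_mul, ← cen_add_left hc]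
  rfl

theorem IsNegAut.exists_map_add {P : Type u} [AddLoop P] {f : P → P} (hf : IsNegAut f) {n k : P}
    (hn : n ∈ nucleus P) (hk : k ∈ moufangCenter P) :
    ∃ c ∈ center P, f (n + k) = n + (c + lneg k) := by
  obtain ⟨c, hc, h⟩ := hf.nuc n hn
  refine ⟨c + (k + f k), add_mem_center hc (hf.mou k hk), ?_⟩
  rw [hf.map_add, h, nuc_left hn, cen_left hc, ← mou_comm (lneg_mem_moufangCenter hk),
    mou_lneg_add_cancel hk]

/-- Change of base point: the arithmetic form can be chosen with any given point as zero. -/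
theorem exists_form (Q : Type u) [FQuasigroup Q] (a : Q) :
    ∃ (P : Type u) (_ : NKLoop P) (f g : P → P) (e : P) (h : Q ≃ P), IsNegAut f ∧ IsNegAut g ∧
      (∀ x, f (g x) = g (f x)) ∧ e ∈ nucleus P ∧ h a = 0 ∧
      ∀ x y, h (x * y) = (f (h x) + e) + g (h y) := by
  have : Nonempty Q := ⟨a⟩
  obtain ⟨P, _, f, g, e, h, hf, hg, hfg, he, hm⟩ := exists_central_form Q
  let τ : P ≃ P :=
    { toFun := fun x => x + h a
      invFun := fun x => rsub x (h a)
      left_inv := fun x => (eq_rsub rfl).symm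
      right_inv := fun x => rsub_add x (h a) }
  have hτ : ∀ x, τ x = x + h a := fun _ => rfl
  obtain ⟨e', he', key⟩ : ∃ e' ∈ nucleus P, ∀ x y, (f (τ x) + e) + g (τ y) = τ ((f x + e') + g y) := by
    obtain ⟨n, hn, k, hk, ha⟩ := nk_cases (h a)
    have hm := lneg_mem_moufangCenter hk
    set m := lneg k
    obtain ⟨c, hc, hfa⟩ := hf.exists_map_add hn hk
    obtain ⟨d, hd, hga⟩ := hg.exists_map_add hn hk
    have hT := three_mem_center hm
    have hw := add_mem_center (add_mem_center hc hd) hT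
    -- With h a = n + k and m = -k, the values f(h a) and g(h a) contribute c + m and d + m; a third
    -- m offsets the k added by τ. The triple is central, so the new constant is nuclear.
    refine ⟨(n + e) + ((c + d) + (m + (m + m))), add_mem_nucleus (add_mem_nucleus hn he) hw.1,
      fun x y => ?_⟩
    rw [hτ, hτ, hτ, hf.map_add, hg.map_add, ha, hfa, hga]
    obtain ⟨p, hp, i, hi, hfx⟩ := nk_cases (f x)
    obtain ⟨q, hq, j, hj, hgy⟩ := nk_cases (g y)
    have hcm := add_mem_moufangCenter hc.2 hm
    have hicm := add_mem_moufangCenter hi hcm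
    rw [hfx, hgy, add_add_add_of_nuc_mou hp hn hi, add_add_add_of_nuc_mou hq hn hj,
      nuc_right he, mou_comm hicm e, ← nuc_left (add_mem_nucleus hp hn),
      add_add_add_of_nuc_mou (add_mem_nucleus (add_mem_nucleus hp hn) he) (add_mem_nucleus hq hn)
        hicm,
      add_add_add_of_nuc_mou hp (add_mem_nucleus hn he) hi,
      add_add_add_of_nuc_mou (add_mem_nucleus hp (add_mem_nucleus hn he)) hq
        (add_mem_moufangCenter hi hw.2),
      add_add_add_of_nuc_mou (add_mem_nucleus (add_mem_nucleus hp (add_mem_nucleus hn he)) hq) hn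
        (add_mem_moufangCenter (add_mem_moufangCenter hi hw.2) hj)]
    congr 1
    · rw [nuc_left hp, nuc_left hp, nuc_left hp, nuc_left hp, nuc_left (add_mem_nucleus hn he),
        nuc_left hn]
    · have e1 : m + (k + (i + j)) = i + j := mou_lneg_add_cancel hk _
      rw [cen_add_left hw, cen_add_left hw, ← cen_comm hw, cen_left (add_mem_center hc hd),
        three_add hm, ← mou_comm hk, e1, cen_mid hc, cen_mid hd, cen_left hc, cen_mid hd,
        cen_left hc, ← mou_comm hm i, ← mou_comm hm j, mou_two hm]
  refine ⟨P, inferInstance, f, g, e', h.trans τ.symm, hf, hg, hfg, he', ?_, fun x y => ?_⟩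
  · rw [Equiv.trans_apply, Equiv.symm_apply_eq, hτ, loop_zero_add]
  · simp only [Equiv.trans_apply]
    rw [Equiv.symm_apply_eq, ← key, Equiv.apply_symm_apply, Equiv.apply_symm_apply, hm]

/-! ### Evaluation of the free commutative ring without unity -/

open scoped IsMulCommutative in
-- The target need not be commutative, but pairwise commuting elements generate a commutative
-- subring, where polynomial evaluation is available.
theorem exists_ringHom_of_comm {U σ : Type*} [Ring U] (a : σ → U)
    (comm : ∀ i j, a i * a j = a j * a i) :
    ∃ Φ : MvPolynomial σ ℤ →+* U, ∀ i, Φ (MvPolynomial.X i) = a i := by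
  have hs : ∀ x ∈ Set.range a, ∀ y ∈ Set.range a, x * y = y * x := by
    rintro _ ⟨i, rfl⟩ _ ⟨j, rfl⟩
    exact comm i j
  have := Subring.isMulCommutative_closure hs
  let Ψ : MvPolynomial σ ℤ →+* Subring.closure (Set.range a) :=
    MvPolynomial.eval₂Hom (Int.castRingHom _) fun i => ⟨a i, Subring.subset_closure ⟨i, rfl⟩⟩
  refine ⟨(Subring.closure (Set.range a)).subtype.comp Ψ, fun i => ?_⟩
  have : Ψ (MvPolynomial.X i) = ⟨a i, Subring.subset_closure ⟨i, rfl⟩⟩ :=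
    MvPolynomial.eval₂Hom_X' _ _ _
  rw [RingHom.comp_apply, this]
  rfl

/-- Evaluate in the unitization of E: polynomials in the augmentation ideal have zero scalar part,
so their values lie in E. -/
theorem exists_nonUnitalRingHom {E : Type*} [NonUnitalRing E] (a : Fin 4 → E)
    (comm : ∀ i j, a i * a j = a j * a i) :
    ∃ ρ : FreeR →ₙ+* E, ∀ i, ρ (gen i) = a i := by
  obtain ⟨Φ, hX⟩ := exists_ringHom_of_comm (fun i => (a i : Unitization ℤ E)) fun i j => by
    rw [← Unitization.inr_mul, comm, Unitization.inr_mul]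
  have hfst : ∀ p ∈ augIdeal, (Φ p).fst = 0 := by
    intro p hp
    have : augIdeal ≤ RingHom.ker ((Unitization.fstHom ℤ E).toRingHom.comp Φ) := by
      refine Ideal.span_le.2 ?_
      rintro _ ⟨i, rfl⟩
      show (Φ (MvPolynomial.X i)).fst = 0
      rw [hX, Unitization.fst_inr]
    exact this hp
  refine ⟨{ toFun := fun p => (Φ p.1).snd, map_zero' := ?_, map_add' := ?_, map_mul' := ?_ }, ?_⟩
  · rintro ⟨p, hp⟩ ⟨q, hq⟩
    show (Φ (p * q)).snd = _
    rw [map_mul, Unitization.snd_mul, hfst p hp, hfst q hq, zero_smul, zero_smul, zero_add,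
      zero_add]
  · show (Φ 0).snd = 0
    simp
  · rintro ⟨p, hp⟩ ⟨q, hq⟩
    show (Φ (p + q)).snd = _
    rw [map_add, Unitization.snd_add]
  · intro i
    show (Φ (MvPolynomial.X i)).snd = a i
    rw [hX, Unitization.snd_inr]

/-! ### Multiples modulo three of elements of the Moufang center -/

section TriMul

variable {P : Type u} [NKLoop P]

/-- Multiples `0`, `k`, `-k`. -/
noncomputable def triMul : ZMod 3 → P → P
  | 0, _ => 0
  | 1, k => k
  | 2, k => lneg k

theorem triMul_zero_left (k : P) : triMul 0 k = 0 := rfl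

theorem triMul_one (k : P) : triMul 1 k = k := rfl

theorem triMul_two (k : P) : triMul 2 k = lneg k := rfl

theorem triMul_zero (m : ZMod 3) : triMul m (0 : P) = 0 := by
  fin_cases m
  exacts [rfl, rfl, lneg_zero]

theorem triMul_mem {k : P} (hk : k ∈ moufangCenter P) (m : ZMod 3) :
    triMul m k ∈ moufangCenter P := by
  fin_cases m
  exacts [zero_mem_moufangCenter, hk, lneg_mem_moufangCenter hk]

theorem triMul_mul {k : P} (hk : k ∈ moufangCenter P) (m m' : ZMod 3) :
    triMul m (triMul m' k) = triMul (m * m') k := by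
  fin_cases m <;> fin_cases m'
  exacts [rfl, rfl, rfl, rfl, rfl, rfl, lneg_zero, rfl, mou_lneg_lneg hk]

theorem cenRel_refl (x : P) : CenRel x x := ⟨0, zero_mem_center, (loop_add_zero x).symm⟩

/-- Central summands collect identically on both sides, so an exact identity can be checked on
representatives modulo the center. -/
theorem medial_of_cenRel {a b c d a' b' c' d' : P} (ha : CenRel a a') (hb : CenRel b b')
    (hc : CenRel c c') (hd : CenRel d d')
    (h : (a' + b') + (c' + d') = (a' + c') + (b' + d')) :
    (a + b) + (c + d) = (a + c) + (b + d) := by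
  obtain ⟨z₁, h₁, rfl⟩ := ha
  obtain ⟨z₂, h₂, rfl⟩ := hb
  obtain ⟨z₃, h₃, rfl⟩ := hc
  obtain ⟨z₄, h₄, rfl⟩ := hd
  rw [cen_add_add h₁ h₂, cen_add_add h₃ h₄, cen_add_add h₁ h₃, cen_add_add h₂ h₄,
    cen_add_add (add_mem_center h₁ h₂) (add_mem_center h₃ h₄),
    cen_add_add (add_mem_center h₁ h₃) (add_mem_center h₂ h₄), h, cen_add_add h₂ h₄]

theorem assoc_of_cenRel {a b c a' b' c' : P} (ha : CenRel a a') (hb : CenRel b b')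
    (hc : CenRel c c') (h : (a' + b') + c' = a' + (b' + c')) : (a + b) + c = a + (b + c) := by
  obtain ⟨z₁, h₁, rfl⟩ := ha
  obtain ⟨z₂, h₂, rfl⟩ := hb
  obtain ⟨z₃, h₃, rfl⟩ := hc
  rw [cen_add_add h₁ h₂, cen_add_add h₂ h₃, cen_add_add (add_mem_center h₁ h₂) h₃,
    cen_add_add h₁ (add_mem_center h₂ h₃), h, nuc_left h₁.1]

theorem add_self_rel_lneg {k : P} (hk : k ∈ moufangCenter P) : CenRel (k + k) (lneg k) :=
  ⟨_, three_mem_center hk, (mou_lneg_add_cancel hk _).symm⟩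

theorem triMul_add {k : P} (hk : k ∈ moufangCenter P) (m m' : ZMod 3) :
    CenRel (triMul m k + triMul m' k) (triMul (m + m') k) := by
  have h1 : ∀ x : P, CenRel (0 + x) x := fun x => by rw [loop_zero_add]; exact cenRel_refl x
  have h2 : ∀ x : P, CenRel (x + 0) x := fun x => by rw [loop_add_zero]; exact cenRel_refl x
  have h3 : CenRel (lneg k + lneg k) k := by
    have := add_self_rel_lneg (lneg_mem_moufangCenter hk)
    rwa [mou_lneg_lneg hk] at this
  have h4 : CenRel (k + lneg k) 0 := by rw [add_lneg]; exact cenRel_refl 0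
  have h5 : CenRel (lneg k + k) 0 := by rw [mou_lneg_add hk]; exact cenRel_refl 0
  fin_cases m <;> fin_cases m'
  exacts [h1 _, h1 _, h1 _, h2 _, add_self_rel_lneg hk, h4, h2 _, h5, h3]

theorem triMul_rel {k l : P} (h : CenRel k l) (m : ZMod 3) :
    CenRel (triMul m k) (triMul m l) := by
  fin_cases m
  exacts [cenRel_refl 0, h, h.lneg]

theorem zmod_three_cases (m : ZMod 3) : m = 0 ∨ m = 1 ∨ m = 2 := by
  revert m
  decide

theorem triMul_assoc {k : P} (hk : k ∈ moufangCenter P) (a b c : ZMod 3) :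
    (triMul a k + triMul b k) + triMul c k = triMul a k + (triMul b k + triMul c k) := by
  have e : ∀ {k : P}, k ∈ moufangCenter P → (k + k) + k = k + (k + k) := fun hk =>
    (mou_comm hk _).symm
  rcases zmod_three_cases a with rfl | rfl | rfl <;>
    rcases zmod_three_cases b with rfl | rfl | rfl <;>
    rcases zmod_three_cases c with rfl | rfl | rfl <;>
    simp only [triMul_zero_left, triMul_one, triMul_two, loop_zero_add, loop_add_zero, add_lneg,
      mou_lneg_add hk, mou_add_lneg_cancel hk, mou_lneg_add_cancel hk, mou_add_add_lneg_cancel hk,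
      mou_add_lneg_add_cancel hk, e hk, e (lneg_mem_moufangCenter hk)]

theorem triMul_medial {k l : P} (hk : k ∈ moufangCenter P) (hl : l ∈ moufangCenter P)
    (a b : ZMod 3) : (triMul a k + triMul a l) + (triMul b k + triMul b l) =
      (triMul a k + triMul b k) + (triMul a l + triMul b l) := by
  rcases zmod_three_cases a with rfl | rfl | rfl <;>
    rcases zmod_three_cases b with rfl | rfl | rfl <;>
    simp only [triMul_zero_left, triMul_one, triMul_two, loop_zero_add, loop_add_zero, add_lneg,
      mou_lneg_add hk, mou_lneg_add hl, ← lneg_add_of_mou hk hl,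
      mou_lneg_add (add_mem_moufangCenter hk hl)]
  · exact mou_two hk _ _
  · rw [lneg_add_of_mou hk hl, mou_two (lneg_mem_moufangCenter hk)]

end TriMul

/-! ### The ring of central-multiple endomorphisms -/

section KEnd

variable (P : Type u) [NKLoop P]

/-- Endomorphisms that are, modulo the center, zero on the nucleus and a multiple of the identity
on the Moufang center. -/
@[ext]
structure KEnd where
  /-- The underlying map. -/
  toFun : P → P
  map_add : ∀ x y, toFun (x + y) = toFun x + toFun y
  exists_triMul : ∃ m : ZMod 3, ∀ n ∈ nucleus P, ∀ k ∈ moufangCenter P,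
    CenRel (toFun (n + k)) (triMul m k)

variable {P}

namespace KEnd

theorem mem (φ : KEnd P) (x : P) : φ.toFun x ∈ moufangCenter P := by
  obtain ⟨m, hm⟩ := φ.exists_triMul
  obtain ⟨n, hn, k, hk, rfl⟩ := nk_cases x
  obtain ⟨z, hz, h⟩ := hm n hn k hk
  rw [h]
  exact add_mem_moufangCenter (triMul_mem hk m) hz.2

theorem map_of_mem {φ : KEnd P} {m : ZMod 3} (h : ∀ n ∈ nucleus P, ∀ k ∈ moufangCenter P,
    CenRel (φ.toFun (n + k)) (triMul m k)) {k : P} (hk : k ∈ moufangCenter P) :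
    CenRel (φ.toFun k) (triMul m k) := by
  simpa using h 0 zero_mem_nucleus k hk

/-- Additivity of a pointwise sum is a medial identity; modulo the center it concerns equal
multiples of two Moufang-central elements. -/
instance : Add (KEnd P) where
  add φ ψ :=
    { toFun := fun x => φ.toFun x + ψ.toFun x
      map_add := fun x y => by
        obtain ⟨m, hm⟩ := φ.exists_triMul
        obtain ⟨m', hm'⟩ := ψ.exists_triMul
        obtain ⟨n, hn, k, hk, rfl⟩ := nk_cases x
        obtain ⟨p, hp, l, hl, rfl⟩ := nk_cases y
        rw [φ.map_add, ψ.map_add]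
        exact medial_of_cenRel (hm n hn k hk) (hm p hp l hl) (hm' n hn k hk) (hm' p hp l hl)
          (triMul_medial hk hl m m')
      exists_triMul := by
        obtain ⟨m, hm⟩ := φ.exists_triMul
        obtain ⟨m', hm'⟩ := ψ.exists_triMul
        exact ⟨m + m', fun n hn k hk =>
          ((hm n hn k hk).add (hm' n hn k hk)).trans (triMul_add hk m m')⟩ }

instance : Zero (KEnd P) where
  zero :=
    { toFun := fun _ => 0
      map_add := fun _ _ => (loop_zero_add 0).symm
      exists_triMul := ⟨0, fun _ _ _ _ => cenRel_refl 0⟩ }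

noncomputable instance : Neg (KEnd P) where
  neg φ :=
    { toFun := fun x => lneg (φ.toFun x)
      map_add := fun x y => by rw [φ.map_add, lneg_add_of_mou (φ.mem x) (φ.mem y)]
      exists_triMul := by
        obtain ⟨m, hm⟩ := φ.exists_triMul
        refine ⟨2 * m, fun n hn k hk => (hm n hn k hk).lneg.trans ?_⟩
        rw [← triMul_mul hk]
        exact cenRel_refl _ }

instance : Mul (KEnd P) where
  mul φ ψ :=
    { toFun := fun x => φ.toFun (ψ.toFun x)
      map_add := fun x y => by rw [ψ.map_add, φ.map_add]
      exists_triMul := by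
        obtain ⟨m, hm⟩ := φ.exists_triMul
        obtain ⟨m', hm'⟩ := ψ.exists_triMul
        refine ⟨m * m', fun n hn k hk => ?_⟩
        rw [← triMul_mul hk]
        exact (map_of_mem hm (ψ.mem _)).trans (triMul_rel (hm' n hn k hk) m) }

/-- Associativity of addition holds exactly because at each point the three summands are, modulo the
center, multiples of one Moufang-central element. Commutativity holds because all values are Moufang
central. -/
noncomputable instance : NonUnitalRing (KEnd P) where
  add_assoc φ ψ χ := by
    ext x
    obtain ⟨m, hm⟩ := φ.exists_triMul
    obtain ⟨m', hm'⟩ := ψ.exists_triMul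
    obtain ⟨m'', hm''⟩ := χ.exists_triMul
    obtain ⟨n, hn, k, hk, rfl⟩ := nk_cases x
    exact assoc_of_cenRel (hm n hn k hk) (hm' n hn k hk) (hm'' n hn k hk) (triMul_assoc hk _ _ _)
  zero_add φ := KEnd.ext (funext fun x => loop_zero_add _)
  add_zero φ := KEnd.ext (funext fun x => loop_add_zero _)
  nsmul := nsmulRec
  zsmul := zsmulRec
  neg_add_cancel φ := KEnd.ext (funext fun x => mou_lneg_add (φ.mem x))
  add_comm φ ψ := KEnd.ext (funext fun x => mou_comm (φ.mem x) _)
  left_distrib φ ψ χ := KEnd.ext (funext fun x => φ.map_add _ _)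
  right_distrib φ ψ χ := rfl
  zero_mul φ := rfl
  mul_zero φ := KEnd.ext (funext fun x => additive_zero φ.map_add)
  mul_assoc φ ψ χ := rfl

end KEnd

end KEnd

/-! ### Generalized modules from arithmetic forms -/

namespace IsNegAut

variable {P : Type u} [NKLoop P] {f : P → P} (hf : IsNegAut f)
include hf

theorem symm {f' : P → P} (h : Function.RightInverse f' f) : IsNegAut f' where
  map_add x y := hf.bij.1 (by rw [h, hf.map_add, h, h])
  bij := by
    have h' : Function.LeftInverse f' f := fun x => hf.bij.1 (h (f x))
    exact ⟨h.injective, h'.surjective⟩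
  nuc n hn := CenRel.of_map hf.map_add hf.bij (by rw [h]; exact (hf.nuc n hn).symm)
  mou k hk := by
    rw [← additive_mem_center_iff hf.map_add hf.bij, hf.map_add, h, ← mou_comm hk]
    exact hf.mou k hk

/-- The nuclear parts cancel and the Moufang parts give -2k, which is k modulo the center since 3k
is central. -/
theorem sub_rel {n k : P} (hn : n ∈ nucleus P) (hk : k ∈ moufangCenter P) :
    CenRel (lneg (n + k) + f (n + k)) k := by
  obtain ⟨c, hc, h⟩ := hf.exists_map_add hn hk
  have hk' := lneg_mem_moufangCenter hk
  rw [h, lneg_add_of_nuc_mou hn hk, add_add_add_of_nuc_mou (lneg_mem_nucleus hn) hn hk',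
    lneg_add_of_nuc hn, loop_zero_add, cen_mid hc]
  have h2 := (add_self_rel_lneg hk').symm
  rw [mou_lneg_lneg hk] at h2
  refine CenRel.trans ?_ h2.symm
  exact ⟨c, hc, cen_comm hc _⟩

/-- The endomorphism `x ↦ -x + f x`. -/
noncomputable def sub : KEnd P where
  toFun x := lneg x + f x
  map_add x y := by
    apply loop_add_left_cancel (a := x + y)
    rw [nk_add_lneg_cancel, hf.map_add]
    conv_lhs => rw [← nk_add_lneg_cancel x (f x), ← nk_add_lneg_cancel y (f y)]
    obtain ⟨n, hn, k, hk, rfl⟩ := nk_cases x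
    obtain ⟨m, hm, l, hl, rfl⟩ := nk_cases y
    obtain ⟨z, hz, h1⟩ := hf.sub_rel hn hk
    obtain ⟨w, hw, h2⟩ := hf.sub_rel hm hl
    rw [h1, h2, nuc_left hn, nuc_left hm, add_add_add_of_nuc_mou hn hm hk,
      nuc_left (add_mem_nucleus hn hm),
      add_add_add_of_nuc_mou hn hm (add_mem_moufangCenter hk (add_mem_moufangCenter hk hz.2))]
    congr 1
    rw [cen_add_add hz hw, cen_add_right (add_mem_center hz hw) (k + l), cen_add_right hz k,
      cen_add_right hw l, cen_add_add hz hw, mou_two hk]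
  exists_triMul := ⟨1, fun _ hn _ hk => hf.sub_rel hn hk⟩

theorem add_sub_apply (x : P) : x + hf.sub.toFun x = f x := nk_add_lneg_cancel x (f x)

omit hf in
theorem sub_mul_sub {f g : P → P} (hf : IsNegAut f) (hg : IsNegAut g)
    (h : ∀ x, f (g x) = g (f x)) : hf.sub * hg.sub = hg.sub * hf.sub := by
  ext x
  show hf.sub.toFun (lneg x + g x) = lneg (hf.sub.toFun x) + g (hf.sub.toFun x)
  rw [hf.sub.map_add, additive_lneg hf.sub.map_add]
  congr 1
  show lneg (g x) + f (g x) = g (lneg x + f x)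
  rw [hg.map_add, additive_lneg hg.map_add, h]

omit hf in
-- Formally, (f - 1) + (f' - 1) + (f - 1)(f' - 1) = f f' - 1.
theorem sub_add_sub {f f' : P → P} (hf : IsNegAut f) (hf' : IsNegAut f')
    (h : ∀ x, f (f' x) = x) : hf.sub + hf'.sub + hf.sub * hf'.sub = 0 := by
  rw [add_right_comm]
  ext x
  show (hf.sub.toFun x + hf.sub.toFun (hf'.sub.toFun x)) + hf'.sub.toFun x = 0
  rw [← hf.sub.map_add, hf'.add_sub_apply]
  show (lneg (f' x) + f (f' x)) + (lneg x + f' x) = 0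
  have h1 := nk_lneg_add_distrib (lneg x) (f' x)
  rw [nk_lneg_lneg] at h1
  rw [h, ← h1, nk_lneg_add]

end IsNegAut

theorem KEnd.map_nucleus_mem_center {P : Type u} [NKLoop P] (φ : KEnd P) {n : P}
    (hn : n ∈ nucleus P) : φ.toFun n ∈ center P := by
  obtain ⟨m, hm⟩ := φ.exists_triMul
  have h := hm n hn 0 zero_mem_moufangCenter
  rw [triMul_zero, loop_add_zero] at h
  exact h.mem zero_mem_center

theorem KEnd.exists_zmul_add_mem_center {P : Type u} [NKLoop P] (φ : KEnd P) {w : P}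
    (hw : w ∈ moufangCenter P) : ∃ m : ℤ, zmul m w + φ.toFun w ∈ center P := by
  obtain ⟨m, hm⟩ := φ.exists_triMul
  obtain ⟨z, hz, h⟩ := KEnd.map_of_mem hm hw
  have key : ∀ m' : ℤ, zmul m' w + triMul m w = 0 → zmul m' w + φ.toFun w ∈ center P :=
    fun m' hm' => by rwa [h, cen_add_right hz, hm', loop_zero_add]
  rcases zmod_three_cases m with rfl | rfl | rfl
  · exact ⟨0, key 0 (loop_zero_add 0)⟩
  · refine ⟨-1, key (-1) ?_⟩
    show (lneg w + 0) + w = 0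
    rw [loop_add_zero, mou_lneg_add hw]
  · refine ⟨1, key 1 ?_⟩
    show (w + 0) + lneg w = 0
    rw [loop_add_zero, add_lneg]

/-- An arithmetic form defines an object of the class `𝓜_n`. -/
theorem exists_Mn {P : Type u} [NKLoop P] {f g : P → P} (hf : IsNegAut f) (hg : IsNegAut g)
    (hfg : ∀ x, f (g x) = g (f x)) {e : P} (he : e ∈ nucleus P) :
    ∃ (B : Mn.{u}) (h : P ≃ B.carrier), h 0 = 0 ∧ h e = B.pt ∧ (∀ x y, h (x + y) = h x + h y) ∧
      (∀ x, h (f x) = h x + gen 0 • h x) ∧ ∀ x, h (g x) = h x + gen 1 • h x := by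
  obtain ⟨f', hff'⟩ := hf.bij.2.hasRightInverse
  obtain ⟨g', hgg'⟩ := hg.bij.2.hasRightInverse
  have hf' := hf.symm hff'
  have hg' := hg.symm hgg'
  have comm_symm : ∀ {a b b' : P → P}, IsNegAut b → Function.RightInverse b' b →
      (∀ x, a (b x) = b (a x)) → ∀ x, a (b' x) = b' (a x) := fun hb h hc x =>
    hb.bij.1 (by rw [← hc, h, h])
  have hff : ∀ x, f (f' x) = f' (f x) := comm_symm hf hff' fun _ => rfl
  have hgg : ∀ x, g (g' x) = g' (g x) := comm_symm hg hgg' fun _ => rfl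
  have hfg' : ∀ x, f (g' x) = g' (f x) := comm_symm hg hgg' hfg
  have hgf' : ∀ x, g (f' x) = f' (g x) := comm_symm hf hff' fun x => (hfg x).symm
  have hf'g' : ∀ x, f' (g' x) = g' (f' x) := comm_symm hg hgg' fun x => (hgf' x).symm
  have c01 := IsNegAut.sub_mul_sub hf hg hfg
  have c02 := IsNegAut.sub_mul_sub hf hf' hff
  have c03 := IsNegAut.sub_mul_sub hf hg' hfg'
  have c12 := IsNegAut.sub_mul_sub hg hf' hgf'
  have c13 := IsNegAut.sub_mul_sub hg hg' hgg
  have c23 := IsNegAut.sub_mul_sub hf' hg' hf'g'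
  obtain ⟨ρ, hρ⟩ := exists_nonUnitalRingHom ![hf.sub, hg.sub, hf'.sub, hg'.sub] (by
    intro i j
    fin_cases i <;> fin_cases j
    exacts [rfl, c01, c02, c03, c01.symm, rfl, c12, c13, c02.symm, c12.symm, rfl, c23, c03.symm,
      c13.symm, c23.symm, rfl])
  -- For z = n + k the sum is 2n + 3k up to the center, and 3k is central.
  have two_add : ∀ {a : P → P} (ha : IsNegAut a) (z : P),
      (z + z) + ha.sub.toFun z ∈ nucleus P := by
    intro a ha z
    obtain ⟨n, hn, k, hk, rfl⟩ := nk_cases z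
    obtain ⟨c, hc, h⟩ : CenRel (ha.sub.toFun (n + k)) k := ha.sub_rel hn hk
    have h3 : (k + k) + (k + c) ∈ nucleus P := by
      rw [cen_add_right hc, ← mou_comm hk]
      exact (add_mem_center (three_mem_center hk) hc).1
    rw [h, add_add_add_of_nuc_mou hn hn hk, nuc_left (add_mem_nucleus hn hn)]
    exact add_mem_nucleus (add_mem_nucleus hn hn) h3
  let _ : GenModule FreeR P :=
    { smul := fun r x => (ρ r).toFun x
      smul_add := fun r => (ρ r).map_add
      add_smul := fun r s x => by
        show (ρ (r + s)).toFun x = _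
        rw [map_add]
        rfl
      smul_smul := fun r s x => by
        show _ = (ρ (r * s)).toFun x
        rw [map_mul]
        rfl
      smul_mem_moufangCenter := fun r => (ρ r).mem
      smul_mem_nucleus := fun r z hz => ((ρ r).map_nucleus_mem_center hz).1
      exists_zmul_add_smul_mem_center := fun r w hw => (ρ r).exists_zmul_add_mem_center hw }
  let _ : MModule P :=
    { two_add_x := fun z => by
        show (z + z) + (ρ (gen 0)).toFun z ∈ _
        rw [hρ]
        exact two_add hf z
      two_add_y := fun z => by
        show (z + z) + (ρ (gen 1)).toFun z ∈ _
        rw [hρ]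
        exact two_add hg z
      ann_xu := fun q => by
        show (ρ (gen 0 + gen 2 + gen 0 * gen 2)).toFun q = 0
        rw [map_add, map_add, map_mul, hρ, hρ]
        exact congrFun (congrArg KEnd.toFun (IsNegAut.sub_add_sub hf hf' hff')) q
      ann_yv := fun q => by
        show (ρ (gen 1 + gen 3 + gen 1 * gen 3)).toFun q = 0
        rw [map_add, map_add, map_mul, hρ, hρ]
        exact congrFun (congrArg KEnd.toFun (IsNegAut.sub_add_sub hg hg' hgg')) q }
  refine ⟨⟨P, e, he⟩, Equiv.refl P, rfl, rfl, fun _ _ => rfl, fun x => ?_, fun x => ?_⟩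
  · show f x = x + (ρ (gen 0)).toFun x
    rw [hρ]
    exact (hf.add_sub_apply x).symm
  · show g x = x + (ρ (gen 1)).toFun x
    rw [hρ]
    exact (hg.add_sub_apply x).symm

/-! ### F-quasigroups from arithmetic forms -/

section ArithmeticForm

variable {P : Type u} [NKLoop P] {f g : P → P} (hf : IsNegAut f) (hg : IsNegAut g)

theorem medial_left {n k : P} (hn : n ∈ nucleus P) (hk : k ∈ moufangCenter P) (y s : P) :
    ((n + k) + y) + (k + s) = ((n + k) + k) + (y + s) := by
  rw [nuc_left hn, nuc_left hn, nuc_left hn, nuc_left hn, mou_two hk]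

theorem medial_right {n k : P} (hn : n ∈ nucleus P) (hk : k ∈ moufangCenter P) (y s : P) :
    (s + k) + (y + (n + k)) = (s + y) + (k + (n + k)) := by
  have h : n + k = k + n := (mou_comm hk n).symm
  rw [h, ← nuc_right hn, ← nuc_right hn, ← nuc_right hn, ← nuc_right hn, ← mou_comm hk s,
    ← mou_comm hk y, mou_two hk, mou_comm (add_mem_moufangCenter hk hk)]

namespace IsNegAut

include hf

theorem map_rel {n k : P} (hn : n ∈ nucleus P) (hk : k ∈ moufangCenter P) :
    CenRel (f (n + k)) (n + lneg k) := by
  obtain ⟨c, hc, h⟩ := hf.exists_map_add hn hk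
  exact ⟨c, hc, by rw [h, cen_mid hc, cen_comm hc]⟩

theorem map_map_rel (x : P) : CenRel (f (f x)) x := by
  obtain ⟨n, hn, k, hk, rfl⟩ := nk_cases x
  have h := hf.map_rel hn (lneg_mem_moufangCenter hk)
  rw [mou_lneg_lneg hk] at h
  exact ((hf.map_rel hn hk).map hf.map_add hf.bij).trans h

theorem lneg_map_map_add_map_rel {n k : P} (hn : n ∈ nucleus P) (hk : k ∈ moufangCenter P) :
    CenRel (lneg (f (f (n + k))) + f (n + k)) k := by
  have hk' := lneg_mem_moufangCenter hk
  have h := (hf.map_map_rel (n + k)).lneg.add (hf.map_rel hn hk)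
  rw [lneg_add_of_nuc_mou hn hk, add_add_add_of_nuc_mou (lneg_mem_nucleus hn) hn hk',
    lneg_add_of_nuc hn, loop_zero_add] at h
  have h2 := add_self_rel_lneg hk'
  rw [mou_lneg_lneg hk] at h2
  exact h.trans h2

theorem map_add_lneg_map_map_rel {n k : P} (hn : n ∈ nucleus P) (hk : k ∈ moufangCenter P) :
    CenRel (f (n + k) + lneg (f (f (n + k)))) k := by
  have hk' := lneg_mem_moufangCenter hk
  have h := (hf.map_rel hn hk).add (hf.map_map_rel (n + k)).lneg
  rw [lneg_add_of_nuc_mou hn hk, add_add_add_of_nuc_mou hn (lneg_mem_nucleus hn) hk',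
    add_lneg, loop_zero_add] at h
  have h2 := add_self_rel_lneg hk'
  rw [mou_lneg_lneg hk] at h2
  exact h.trans h2

/-- In the application F is f(g(αx)), and h is f applied to x * αx = x. Modulo the center f(f x) is
x and f e + F is the Moufang part of x, so the Moufang identity exchanges that part with Y; e and f
e differ by a central element, which cancels. -/
theorem left_law {e x F : P} (he : e ∈ nucleus P) (h : (f (f x) + f e) + F = f x) (Y S : P) :
    (((f (f x) + f e) + Y) + e) + (F + S) = (f x + e) + (Y + S) := by
  obtain ⟨n, hn, k, hk, rfl⟩ := nk_cases x
  obtain ⟨z, hz, hez⟩ := hf.nuc e he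
  have hfe : f e ∈ nucleus P := by rw [hez]; exact add_mem_nucleus he hz.1
  have hfe' := lneg_mem_nucleus hfe
  rw [nuc_mid hfe] at h
  have hk₁ : CenRel (f e + F) k := by
    have := nk_lneg_add_cancel (f (f (n + k))) (f e + F)
    rw [h] at this
    rw [← this]
    exact hf.lneg_map_map_add_map_rel hn hk
  have key := fun y s => medial_of_cenRel (hf.map_map_rel (n + k)) (cenRel_refl y) hk₁
    (cenRel_refl s) (medial_left hn hk y s)
  have hF : F = (f e + F) + lneg (f e) := by
    obtain ⟨c, hc, h'⟩ := hk₁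
    rw [h', mou_comm (add_mem_moufangCenter hk hc.2), ← h', nk_lneg_add_cancel]
  have hz' : e + lneg (f e) = lneg z := by
    apply loop_add_right_cancel (a := f e)
    rw [nuc_mid hfe', nk_lneg_add, loop_add_zero, hez, ← cen_comm hz, nk_lneg_add_cancel]
  conv_lhs => rw [hF]
  rw [nuc_mid hfe', nuc_mid hfe, nuc_right he, key, h, nuc_mid he, nuc_mid he, nuc_left hfe,
    ← nuc_left he (lneg (f e)), hz', cen_mid (lneg_mem_center hz), hez, nuc_left he,
    nk_add_lneg_cancel]

theorem right_law {e x F : P} (he : e ∈ nucleus P) (h : (F + f e) + f (f x) = f x) (Y S : P) :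
    ((S + F) + e) + ((Y + f e) + f (f x)) = ((S + Y) + e) + f x := by
  obtain ⟨n, hn, k, hk, rfl⟩ := nk_cases x
  obtain ⟨z, hz, hez⟩ := hf.nuc e he
  have hfe : f e ∈ nucleus P := by rw [hez]; exact add_mem_nucleus he hz.1
  have hfe' := lneg_mem_nucleus hfe
  have hk₁ : CenRel (F + f e) k := by
    have := nk_add_add_lneg (F + f e) (f (f (n + k)))
    rw [h] at this
    rw [← this]
    exact hf.map_add_lneg_map_map_rel hn hk
  have key := fun y s => medial_of_cenRel (cenRel_refl s) hk₁ (cenRel_refl y)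
    (hf.map_map_rel (n + k)) (medial_right hn hk y s)
  have hz' : lneg (f e) + e = lneg z := by
    apply loop_add_left_cancel (a := f e)
    rw [nk_add_lneg_cancel, hez, nuc_left he, add_lneg, loop_add_zero]
  conv_lhs => rw [← nk_add_add_lneg F (f e)]
  rw [← nuc_right hfe', nuc_mid he, nuc_mid hfe', ← nuc_left he, ← nuc_left hfe',
    ← nuc_left he, ← nuc_left hfe', ← nuc_left hfe' e Y, hz', key, h, hez,
    cen_left (lneg_mem_center hz),
    cen_add_right hz Y, ← cen_comm hz, nk_lneg_add_cancel, nuc_right he]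

omit hf in
theorem elastic {f g : P → P} (hf : IsNegAut f) (hg : IsNegAut g) (x y : P) :
    (f (f x) + y) + g (g x) = f (f x) + (y + g (g x)) := by
  refine assoc_of_cenRel (hf.map_map_rel x) (cenRel_refl y) (hg.map_map_rel x) ?_
  obtain ⟨n, hn, k, hk, rfl⟩ := nk_cases x
  have h : (k + y) + k = k + (y + k) := by rw [← mou_comm hk, ← mou_comm hk y]
  rw [← mou_comm hk n, ← nuc_right hn, ← nuc_right hn, ← nuc_right hn, mou_comm hk n, nuc_left hn,
    nuc_left hn, nuc_left hn, h, nuc_left hn, nuc_left hn]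

end IsNegAut

/-- The distinguished element `0` of an arithmetic form lies in `M(Q)` if and only if the nuclear
element of the form is central. -/
theorem arithmeticForm_mem_mSet_iff (hf : IsNegAut f) (hg : IsNegAut g)
    (hfg : ∀ x, f (g x) = g (f x)) {e : P} (he : e ∈ nucleus P) {Q : Type u} [Quasigroup Q]
    (h : Q ≃ P) (h_mul : ∀ x y : Q, h (x * y) = (f (h x) + e) + g (h y)) {a : Q} (ha : h a = 0) :
    a ∈ mSet Q ↔ e ∈ center P := by
  have hfe := (additive_mem_nucleus_iff hf.map_add hf.bij).2 he
  have hge := (additive_mem_nucleus_iff hg.map_add hg.bij).2 he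
  have key : a ∈ mSet Q ↔ ∀ x y : P, ((f (f x) + f e) + e) + ((y + g e) + g (g x)) =
      (((f (f x) + f e) + y) + e) + (g e + g (g x)) := by
    have hl : ∀ x y : Q, h ((x * a) * (y * x)) =
        ((f (f (h x)) + f e) + e) + ((f (g (h y)) + g e) + g (g (h x))) := fun x y => by
      simp only [h_mul, ha, hf.map_add, hg.map_add, additive_zero hg.map_add, loop_add_zero, hfg]
    have hr : ∀ x y : Q, h ((x * y) * (a * x)) =
        (((f (f (h x)) + f e) + f (g (h y))) + e) + (g e + g (g (h x))) := fun x y => by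
      simp only [h_mul, ha, hf.map_add, hg.map_add, additive_zero hf.map_add, loop_zero_add]
    constructor
    · intro hM x y
      obtain ⟨y, rfl⟩ := (hf.bij.comp hg.bij).2 y
      have := congrArg h (hM (h.symm x) (h.symm y))
      rwa [hl, hr, h.apply_symm_apply, h.apply_symm_apply] at this
    · exact fun hM x y => h.injective (by rw [hl, hr, hM])
  rw [key]
  constructor
  · intro hM
    refine center_of_nuc he fun y => ?_
    -- At x = 0 everything but the commutation of e with y cancels.
    have h0 := hM 0 y
    rw [additive_zero hf.map_add, additive_zero hf.map_add, additive_zero hg.map_add,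
      additive_zero hg.map_add, loop_zero_add, loop_add_zero, loop_add_zero, ← nuc_right hge] at h0
    have h1 := loop_add_right_cancel h0
    rw [nuc_left hfe, nuc_left hfe] at h1
    exact loop_add_left_cancel h1
  · intro hc x y
    have hfc := (additive_mem_center_iff hf.map_add hf.bij).2 hc
    have hgc := (additive_mem_center_iff hg.map_add hg.bij).2 hc
    rw [cen_add_left hgc y, cen_add_right hgc, cen_add_left hc, cen_add_left hfc, cen_comm hgc,
      cen_add_right hgc, cen_add_left hc _ (g (g x)), cen_add_left hfc _ y,
      cen_add_left hfc _ (g (g x)), IsNegAut.elastic hf hg]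

/-- A copy of `P`, carrying the quasigroup operation of an arithmetic form. -/
theorem exists_FQuasigroup (hf : IsNegAut f) (hg : IsNegAut g) (hfg : ∀ x, f (g x) = g (f x))
    {e : P} (he : e ∈ nucleus P) :
    ∃ (Q : Type u) (_ : FQuasigroup Q) (h : Q ≃ P),
      ∀ x y : Q, h (x * y) = (f (h x) + e) + g (h y) := by
  obtain ⟨f', hf'⟩ := Function.bijective_iff_has_inverse.1 hf.bij
  obtain ⟨g', hg'⟩ := Function.bijective_iff_has_inverse.1 hg.bij
  let _ : Quasigroup P :=
    { mul := fun x y => (f x + e) + g y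
      existsUnique_mul_left := fun a b =>
        ⟨g' (lsub (f a + e) b), (congrArg _ (hg'.2 _)).trans (add_lsub _ _), fun y hy => by
          rw [← eq_lsub hy, hg'.1]⟩
      existsUnique_mul_right := fun a b =>
        ⟨f' (rsub (rsub b (g a)) e), by
          show (f _ + e) + g a = b
          rw [hf'.2, rsub_add, rsub_add], fun y hy => by
          rw [← eq_rsub hy, ← eq_rsub rfl, hf'.1]⟩ }
  have mul_def : ∀ x y : P, x * y = (f x + e) + g y := fun _ _ => rfl
  have hfe := (additive_mem_nucleus_iff hf.map_add hf.bij).2 he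
  have hge := (additive_mem_nucleus_iff hg.map_add hg.bij).2 he
  refine ⟨P, { left_F := fun x y z => ?_, right_F := fun x y z => ?_ }, Equiv.refl P,
    fun _ _ => rfl⟩
  · have h : (f x + e) + g (alpha x) = x := mul_ldiv x x
    replace h := congrArg f h
    rw [hf.map_add, hf.map_add] at h
    simp only [mul_def, hf.map_add, hg.map_add]
    rw [hfg (alpha x)] at h
    have := hf.left_law he h (g (f y)) (g e + g (g z))
    rw [hfg, nuc_mid hge, nuc_mid hge, this]
  · have h : (f (beta x) + e) + g x = x := rdiv_mul x x
    replace h := congrArg g h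
    rw [hg.map_add, hg.map_add] at h
    simp only [mul_def, hf.map_add, hg.map_add]
    rw [hfg, hfg, hg.right_law he h]

end ArithmeticForm

/-! ### Arithmetic forms from generalized modules -/

section Scalar

variable {P : Type u} [NKLoop P]

/-- Endomorphisms that are, modulo the center, zero on the nucleus and the identity on the Moufang
center. -/
structure IsMouProj (X : P → P) : Prop where
  map_add : ∀ x y, X (x + y) = X x + X y
  rel : ∀ n ∈ nucleus P, ∀ k ∈ moufangCenter P, CenRel (X (n + k)) k

namespace IsMouProj

theorem of_add {X : P → P} (map_add : ∀ x y, X (x + y) = X x + X y)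
    (mou : ∀ x, X x ∈ moufangCenter P) (nuc : ∀ x ∈ nucleus P, X x ∈ nucleus P)
    (rel : ∀ k ∈ moufangCenter P, CenRel (X k) k) : IsMouProj X where
  map_add := map_add
  rel n hn k hk := by
    obtain ⟨z, hz, h⟩ := rel k hk
    have hn' : X n ∈ center P := ⟨nuc n hn, mou n⟩
    exact ⟨X n + z, add_mem_center hn' hz, by rw [map_add, h, cen_mid hn']⟩

/-- For k in the Moufang center, 2k + X k is both nuclear and Moufang central; hence X k is -2k,
that is k, modulo the center. -/
theorem of_two_add {X : P → P} (map_add : ∀ x y, X (x + y) = X x + X y)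
    (mou : ∀ x, X x ∈ moufangCenter P) (nuc : ∀ x ∈ nucleus P, X x ∈ nucleus P)
    (two : ∀ x, (x + x) + X x ∈ nucleus P) : IsMouProj X :=
  of_add map_add mou nuc fun k hk => by
    have hkk := add_mem_moufangCenter hk hk
    have h : CenRel (X k) (lneg (k + k)) :=
      ⟨(k + k) + X k, ⟨two k, add_mem_moufangCenter hkk (mou k)⟩, (nk_lneg_add_cancel _ _).symm⟩
    have h2 := (add_self_rel_lneg hk).lneg
    rw [mou_lneg_lneg hk] at h2
    exact h.trans h2

/-- On k the relation reads k + 2 U k = 0 modulo the center, and 2 U k is -U k there. -/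
theorem of_add_add {X U : P → P} (hX : IsMouProj X) (map_add : ∀ x y, U (x + y) = U x + U y)
    (mou : ∀ x, U x ∈ moufangCenter P) (nuc : ∀ x ∈ nucleus P, U x ∈ nucleus P)
    (h : ∀ x, (X x + U x) + X (U x) = 0) : IsMouProj U :=
  of_add map_add mou nuc fun k hk => by
    have rel : ∀ l ∈ moufangCenter P, CenRel (X l) l := fun l hl => by
      simpa using hX.rel 0 zero_mem_nucleus l hl
    have hl := mou k
    have h1 : CenRel 0 (k + (U k + U k)) := by
      rw [← h k, ← mou_comm (add_mem_moufangCenter hl hl), mou_alt hl, mou_comm hl k,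
        mou_comm hl]
      exact ((rel k hk).add (cenRel_refl _)).add (rel _ hl)
    have h2 := (h1.trans ((cenRel_refl k).add (add_self_rel_lneg hl))).add (cenRel_refl (U k))
    rw [loop_zero_add, mou_add_lneg_add_cancel hl] at h2
    exact h2

variable {X Y : P → P} (hX : IsMouProj X) (hY : IsMouProj Y)

include hX hY in
theorem map_map_rel {n k : P} (hn : n ∈ nucleus P) (hk : k ∈ moufangCenter P) :
    CenRel (X (Y (n + k))) k := by
  obtain ⟨z, hz, h⟩ := hY.rel n hn k hk
  rw [h]
  have := hX.rel z hz.1 k hk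
  rwa [cen_comm hz] at this

include hX in
theorem self_add (x y : P) : (x + y) + X (x + y) = (x + X x) + (y + X y) := by
  obtain ⟨n, hn, k, hk, rfl⟩ := nk_cases x
  obtain ⟨m, hm, l, hl, rfl⟩ := nk_cases y
  rw [hX.map_add]
  refine medial_of_cenRel (cenRel_refl _) (cenRel_refl _) (hX.rel n hn k hk) (hX.rel m hm l hl) ?_
  rw [nuc_left hn k k, nuc_left hm l l, add_add_add_of_nuc_mou hn hm hk,
    nuc_left (add_mem_nucleus hn hm),
    add_add_add_of_nuc_mou hn hm (add_mem_moufangCenter hk hk), mou_two hk]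

include hX hY in
theorem self_add_self_add (x : P) :
    (x + Y x) + X (x + Y x) = x + (Y x + (X x + X (Y x))) := by
  obtain ⟨n, hn, k, hk, rfl⟩ := nk_cases x
  have h1 := hX.rel n hn k hk
  have h2 := hY.rel n hn k hk
  have h3 := hX.map_map_rel hY hn hk
  rw [hX.map_add]
  refine assoc_of_cenRel (cenRel_refl _) h2 (h1.add h3) ?_
  rw [nuc_left hn, nuc_left hn, nuc_left hn]
  rw [mou_alt hk]

include hX hY in
theorem self_add_comm (h : ∀ x, X (Y x) = Y (X x)) (x : P) :
    (x + Y x) + X (x + Y x) = (x + X x) + Y (x + X x) := by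
  rw [hX.self_add_self_add hY, hY.self_add_self_add hX, h]
  congr 1
  obtain ⟨n, hn, k, hk, rfl⟩ := nk_cases x
  have h1 := hX.rel n hn k hk
  have h2 := hY.rel n hn k hk
  have h3 := hY.map_map_rel hX hn hk
  rw [← assoc_of_cenRel h1 h2 h3 (mou_comm hk _).symm,
    ← assoc_of_cenRel h2 h1 h3 (mou_comm hk _).symm]
  congr 1
  obtain ⟨z, hz, h1⟩ := h1
  rw [h1, mou_comm (add_mem_moufangCenter hk hz.2)]

include hX hY in
-- This is (1 + X)(1 + Y) = 1; the reassociation is legitimate because the terms are, modulo the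
-- center, a common Moufang-central k.
theorem self_add_of_add_add (h : ∀ x, (X x + Y x) + X (Y x) = 0) (x : P) :
    (x + Y x) + X (x + Y x) = x := by
  rw [hX.self_add_self_add hY]
  obtain ⟨n, hn, k, hk, rfl⟩ := nk_cases x
  have h1 := hX.rel n hn k hk
  have h2 := hY.rel n hn k hk
  have h3 := hX.map_map_rel hY hn hk
  rw [← assoc_of_cenRel h2 h1 h3 (mou_comm hk _).symm]
  obtain ⟨z, hz, h1⟩ := h1
  have := h (n + k)
  rw [h1, mou_comm (add_mem_moufangCenter hk hz.2)] at this
  rw [h1, this, loop_add_zero]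

include hX hY in
theorem isNegAut (h : ∀ x, (X x + Y x) + X (Y x) = 0) (h' : ∀ x, (Y x + X x) + Y (X x) = 0) :
    IsNegAut fun x => x + X x where
  map_add := hX.self_add
  bij := Function.bijective_iff_has_inverse.2
    ⟨fun x => x + Y x, hY.self_add_of_add_add hX h', hX.self_add_of_add_add hY h⟩
  nuc n hn := by
    obtain ⟨z, hz, h⟩ := hX.rel n hn 0 zero_mem_moufangCenter
    rw [loop_zero_add, loop_add_zero] at h
    exact ⟨z, hz, by rw [h]⟩
  mou k hk := by
    obtain ⟨z, hz, h⟩ := hX.rel 0 zero_mem_nucleus k hk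
    rw [loop_zero_add] at h
    show k + (k + X k) ∈ _
    rw [h, cen_add_right hz, cen_add_right hz, ← mou_comm hk]
    exact add_mem_center (three_mem_center hk) hz

end IsMouProj

end Scalar

/-! ### The generators acting on an object of 𝓜. -/

section MModule

variable {P : Type u} [MModule P]

theorem annihilator_swap {r s : FreeR} (h : r + s + r * s ∈ annihilator FreeR P) :
    s + r + s * r ∈ annihilator FreeR P := by
  rwa [add_comm s, mul_comm s]

theorem smul_of_annihilator {r s : FreeR} (h : r + s + r * s ∈ annihilator FreeR P) (x : P) :
    (r • x + s • x) + r • s • x = 0 := by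
  rw [GenModule.smul_smul, ← GenModule.add_smul, ← GenModule.add_smul]
  exact h x

theorem isMouProj_of_two_add {r : FreeR} (h : ∀ z : P, (z + z) + r • z ∈ nucleus P) :
    IsMouProj fun x : P => r • x :=
  .of_two_add (GenModule.smul_add r) (GenModule.smul_mem_moufangCenter r)
    (GenModule.smul_mem_nucleus r) h

theorem isMouProj_of_annihilator {r s : FreeR} (h : ∀ z : P, (z + z) + r • z ∈ nucleus P)
    (hrs : r + s + r * s ∈ annihilator FreeR P) : IsMouProj fun x : P => s • x :=
  (isMouProj_of_two_add h).of_add_add (GenModule.smul_add s) (GenModule.smul_mem_moufangCenter s)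
    (GenModule.smul_mem_nucleus s) (smul_of_annihilator hrs)

theorem isNegAut_of_two_add {r s : FreeR} (h : ∀ z : P, (z + z) + r • z ∈ nucleus P)
    (hrs : r + s + r * s ∈ annihilator FreeR P) : IsNegAut fun x : P => x + r • x :=
  (isMouProj_of_two_add h).isNegAut (isMouProj_of_annihilator h hrs) (smul_of_annihilator hrs)
    (smul_of_annihilator (annihilator_swap hrs))

theorem eq_add_smul_of_two_add {r s : FreeR} (h : ∀ z : P, (z + z) + r • z ∈ nucleus P)
    (hrs : r + s + r * s ∈ annihilator FreeR P) {w x : P} (hw : w + r • w = x) : w = x + s • x :=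
  (isNegAut_of_two_add h hrs).bij.1 (hw.trans ((isMouProj_of_two_add h).self_add_of_add_add
    (isMouProj_of_annihilator h hrs) (smul_of_annihilator hrs) x).symm)

theorem isNegAut_x : IsNegAut fun x : P => x + gen 0 • x :=
  isNegAut_of_two_add MModule.two_add_x MModule.ann_xu

theorem isNegAut_y : IsNegAut fun x : P => x + gen 1 • x :=
  isNegAut_of_two_add MModule.two_add_y MModule.ann_yv

theorem self_add_x_y (x : P) : (x + gen 1 • x) + gen 0 • (x + gen 1 • x) =
    (x + gen 0 • x) + gen 1 • (x + gen 0 • x) :=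
  (isMouProj_of_two_add MModule.two_add_x).self_add_comm
    (isMouProj_of_two_add MModule.two_add_y)
    (fun x => by rw [GenModule.smul_smul, GenModule.smul_smul, mul_comm]) x

end MModule

/-! ### Induction for the free commutative ring without unity -/

/-- An ideal is spanned with polynomial coefficients, but these act by ring operations without
unity: integers by repeated addition and negation, indeterminates by multiplication by generators.
-/
theorem freeR_induction {motive : FreeR → Prop} (mem : ∀ i, motive (gen i))
    (add : ∀ r s, motive r → motive s → motive (r + s)) (neg : ∀ r, motive r → motive (-r))
    (mul : ∀ r s, motive r → motive s → motive (r * s)) (r : FreeR) : motive r := by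
  have zero : motive 0 := by
    rw [← add_neg_cancel (gen 0)]
    exact add _ _ (mem 0) (neg _ (mem 0))
  have smul : ∀ (q : MvPolynomial (Fin 4) ℤ) (r : FreeR), motive r → motive (q • r) := fun q => by
    induction q using MvPolynomial.induction_on with
    | C a =>
      intro r hr
      have h : (MvPolynomial.C a : MvPolynomial (Fin 4) ℤ) • r = a • r :=
        Subtype.ext (by simp)
      rw [h]
      clear h
      induction a with
      | zero => rwa [zero_smul]
      | succ n ih =>
        rw [add_smul, one_smul]
        exact add _ _ ih hr
      | pred n ih =>
        rw [sub_smul, one_smul, sub_eq_add_neg]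
        exact add _ _ ih (neg _ hr)
    | add p q hp hq =>
      intro r hr
      rw [add_smul]
      exact add _ _ (hp r hr) (hq r hr)
    | mul_X p i hp =>
      intro r hr
      have h : (MvPolynomial.X i : MvPolynomial (Fin 4) ℤ) • r = gen i * r := rfl
      rw [mul_smul, h]
      exact hp _ (mul _ _ (mem i) hr)
  have key : ∀ p (hp : p ∈ Ideal.span (Set.range MvPolynomial.X)), motive ⟨p, hp⟩ := by
    intro p hp
    induction hp using Submodule.span_induction with
    | mem p hp =>
      obtain ⟨i, rfl⟩ := hp
      exact mem i
    | zero => exact zero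
    | add p q hp hq h h' => exact add _ _ h h'
    | smul q p hp h => exact smul q _ h
  exact key r.1 r.2

/-! ### Corresponding objects -/

/-- A bijection `h` identifies the pointed F-quasigroup `A` with the quasigroup given by the
arithmetic form of `B`, pointed by `0`. -/
structure Compat (A : Fp.{u}) (B : Mn.{u}) (h : A.carrier ≃ B.carrier) : Prop where
  pt : h A.pt = 0
  mul : ∀ x y, h (x * y) = ((h x + gen 0 • h x) + B.pt) + (h y + gen 1 • h y)

theorem exists_compat_Mn (A : Fp.{u}) : ∃ (B : Mn.{u}) (h : A.carrier ≃ B.carrier),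
    Compat A B h := by
  obtain ⟨P, _, f, g, e, h, hf, hg, hfg, he, h0, hm⟩ := exists_form A.carrier A.pt
  obtain ⟨B, k, k0, ke, k_add, kf, kg⟩ := exists_Mn hf hg hfg he
  refine ⟨B, h.trans k, (congrArg k h0).trans k0, fun x y => ?_⟩
  simp only [Equiv.trans_apply, hm, k_add, kf, kg, ke]

theorem exists_compat_Fp (B : Mn.{u}) : ∃ (A : Fp.{u}) (h : A.carrier ≃ B.carrier),
    Compat A B h := by
  obtain ⟨Q, _, h, hm⟩ := exists_FQuasigroup (P := B.carrier) isNegAut_x isNegAut_y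
    self_add_x_y B.pt_mem
  exact ⟨⟨Q, h.symm 0⟩, h, h.apply_symm_apply 0, hm⟩

theorem zero_smul_eq_zero {P : Type u} [MModule P] (x : P) : (0 : FreeR) • x = 0 := by
  apply loop_add_left_cancel (a := (0 : FreeR) • x)
  rw [← GenModule.add_smul, add_zero, loop_add_zero]

theorem zero_add_x {P : Type u} [MModule P] : (0 : P) + gen 0 • (0 : P) = 0 :=
  additive_zero (f := fun x : P => x + gen 0 • x) isNegAut_x.map_add

theorem zero_add_y {P : Type u} [MModule P] : (0 : P) + gen 1 • (0 : P) = 0 :=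
  additive_zero (f := fun x : P => x + gen 1 • x) isNegAut_y.map_add

namespace Compat

variable {A : Fp.{u}} {B : Mn.{u}} {h : A.carrier ≃ B.carrier} (c : Compat A B h)
include c

theorem isFm_iff : isFm A ↔ isMc B :=
  arithmeticForm_mem_mSet_iff (P := B.carrier) isNegAut_x isNegAut_y self_add_x_y B.pt_mem h c.mul
    c.pt

theorem pt_mul (y : A.carrier) : h (A.pt * y) = B.pt + (h y + gen 1 • h y) := by
  rw [c.mul, c.pt, zero_add_x, loop_zero_add]

theorem mul_pt (x : A.carrier) : h (x * A.pt) = (h x + gen 0 • h x) + B.pt := by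
  rw [c.mul, c.pt, zero_add_y, loop_add_zero]

theorem pt_mul_pt : h (A.pt * A.pt) = B.pt := by
  rw [c.pt_mul, c.pt, zero_add_y, loop_add_zero]

/-- The element α(a) cancels the constant of the form, so that right multiplication by it is exactly
1 + x. Similarly, left multiplication by β(a) is 1 + y. -/
theorem alpha_pt : h (alpha A.pt) + gen 1 • h (alpha A.pt) = lneg B.pt :=
  eq_lneg (by rw [← c.pt_mul, alpha, mul_ldiv, c.pt])

theorem beta_pt : h (beta A.pt) + gen 0 • h (beta A.pt) = lneg B.pt := by
  have h1 := c.mul_pt (beta A.pt)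
  rw [beta, rdiv_mul, c.pt] at h1
  apply loop_add_right_cancel (a := B.pt)
  rw [beta, ← h1, nk_lneg_add]

theorem mul_alpha_pt (x : A.carrier) : h (x * alpha A.pt) = h x + gen 0 • h x := by
  rw [c.mul, c.alpha_pt, nk_add_add_lneg]

theorem beta_pt_mul (x : A.carrier) : h (beta A.pt * x) = h x + gen 1 • h x := by
  rw [c.mul, c.beta_pt, nk_lneg_add, loop_zero_add]

theorem rdiv_alpha_pt_add (x : A.carrier) : h (rdiv x (alpha A.pt)) +
    gen 0 • h (rdiv x (alpha A.pt)) = h x := by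
  rw [← c.mul_alpha_pt, rdiv_mul]

theorem ldiv_beta_pt_add (x : A.carrier) : h (ldiv (beta A.pt) x) +
    gen 1 • h (ldiv (beta A.pt) x) = h x := by
  rw [← c.beta_pt_mul, mul_ldiv]

theorem rdiv_alpha_pt (x : A.carrier) : h (rdiv x (alpha A.pt)) = h x + gen 2 • h x :=
  eq_add_smul_of_two_add MModule.two_add_x MModule.ann_xu (c.rdiv_alpha_pt_add x)

theorem ldiv_beta_pt (x : A.carrier) : h (ldiv (beta A.pt) x) = h x + gen 3 • h x :=
  eq_add_smul_of_two_add MModule.two_add_y MModule.ann_yv (c.ldiv_beta_pt_add x)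

theorem ldiv_pt (y : A.carrier) : B.pt + (h (ldiv A.pt y) + gen 1 • h (ldiv A.pt y)) = h y := by
  rw [← c.pt_mul, mul_ldiv]

theorem add (x y : A.carrier) : h (rdiv x (alpha A.pt) * ldiv A.pt y) = h x + h y := by
  rw [c.mul, c.rdiv_alpha_pt_add, nuc_mid B.pt_mem, c.ldiv_pt]

theorem lsub (x y : A.carrier) :
    h (A.pt * ldiv (rdiv x (alpha A.pt)) y) = lsub (h x) (h y) := by
  apply eq_lsub
  rw [c.pt_mul, ← nuc_mid B.pt_mem, ← c.rdiv_alpha_pt_add x, ← c.mul, mul_ldiv]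

theorem rsub (x y : A.carrier) :
    h (rdiv y (ldiv A.pt x) * alpha A.pt) = rsub (h y) (h x) := by
  apply eq_rsub
  rw [c.mul_alpha_pt, ← c.ldiv_pt x, ← nuc_mid B.pt_mem, ← c.mul, rdiv_mul]

theorem ldiv (x y : A.carrier) : h (FQuasi.ldiv x y) =
    FQuasi.lsub ((h x + gen 0 • h x) + B.pt) (h y) +
      gen 3 • FQuasi.lsub ((h x + gen 0 • h x) + B.pt) (h y) :=
  eq_add_smul_of_two_add MModule.two_add_y MModule.ann_yv (eq_lsub (by rw [← c.mul, mul_ldiv]))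

theorem rdiv (y x : A.carrier) : h (FQuasi.rdiv y x) =
    FQuasi.rsub (FQuasi.rsub (h y) (h x + gen 1 • h x)) B.pt +
      gen 2 • FQuasi.rsub (FQuasi.rsub (h y) (h x + gen 1 • h x)) B.pt :=
  eq_add_smul_of_two_add MModule.two_add_x MModule.ann_xu
    (eq_rsub (eq_rsub (by rw [← c.mul, rdiv_mul])))

end Compat

/-! ### Terms of quasigroups -/

section QTerm

open FirstOrder Language

variable {α : Type}

/-- The distinguished element as a term. -/
def qPt : qLang.Term α := .func (QOp.pt : qLang.Functions 0) Fin.elim0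

/-- The product of terms. -/
def qMul (s t : qLang.Term α) : qLang.Term α :=
  Functions.apply₂ (QOp.mul : qLang.Functions 2) s t

/-- The left division of terms. -/
def qLdiv (s t : qLang.Term α) : qLang.Term α :=
  Functions.apply₂ (QOp.ldiv : qLang.Functions 2) s t

/-- The right division of terms. -/
def qRdiv (s t : qLang.Term α) : qLang.Term α :=
  Functions.apply₂ (QOp.rdiv : qLang.Functions 2) s t

variable {A : Fp.{u}} (v : α → A.carrier) (s t : qLang.Term α)

theorem realize_qPt : (qPt : qLang.Term α).realize v = A.pt := rfl

theorem realize_qMul : (qMul s t).realize v = s.realize v * t.realize v :=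
  Term.realize_functions_apply₂

theorem realize_qLdiv : (qLdiv s t).realize v = ldiv (s.realize v) (t.realize v) :=
  Term.realize_functions_apply₂

theorem realize_qRdiv : (qRdiv s t).realize v = rdiv (s.realize v) (t.realize v) :=
  Term.realize_functions_apply₂

/-- The image of the distinguished element under `α`, as a term. -/
def qAlpha : qLang.Term α := qLdiv qPt qPt

/-- The image of the distinguished element under `β`, as a term. -/
def qBeta : qLang.Term α := qRdiv qPt qPt

theorem realize_qAlpha : (qAlpha : qLang.Term α).realize v = alpha A.pt := realize_qLdiv _ _ _

theorem realize_qBeta : (qBeta : qLang.Term α).realize v = beta A.pt := realize_qRdiv _ _ _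

/-- The addition of the generalized module in terms of the quasigroup. -/
def qAdd (s t : qLang.Term α) : qLang.Term α := qMul (qRdiv s qAlpha) (qLdiv qPt t)

/-- The left subtraction of the generalized module in terms of the quasigroup. -/
def qLsub (s t : qLang.Term α) : qLang.Term α := qMul qPt (qLdiv (qRdiv s qAlpha) t)

/-- The right subtraction of the generalized module in terms of the quasigroup. -/
def qRsub (s t : qLang.Term α) : qLang.Term α := qMul (qRdiv s (qLdiv qPt t)) qAlpha

variable {B : Mn.{u}} {h : A.carrier ≃ B.carrier} (c : Compat A B h)
include c

theorem Compat.realize_qAdd : h ((qAdd s t).realize v) = h (s.realize v) + h (t.realize v) := by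
  rw [qAdd, realize_qMul, realize_qRdiv, realize_qAlpha, realize_qLdiv, realize_qPt, c.add]

theorem Compat.realize_qLsub :
    h ((qLsub s t).realize v) = FQuasi.lsub (h (s.realize v)) (h (t.realize v)) := by
  rw [qLsub, realize_qMul, realize_qLdiv, realize_qRdiv, realize_qAlpha, realize_qPt, c.lsub]

theorem Compat.realize_qRsub :
    h ((qRsub s t).realize v) = FQuasi.rsub (h (s.realize v)) (h (t.realize v)) := by
  rw [qRsub, realize_qMul, realize_qRdiv, realize_qLdiv, realize_qAlpha, realize_qPt, c.rsub]

omit c in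
/-- Scalar multiplications are given by terms. -/
theorem exists_smul_term (r : FreeR) (t : qLang.Term α) : ∃ t' : qLang.Term α,
    ∀ (A : Fp.{u}) (B : Mn.{u}) (h : A.carrier ≃ B.carrier), Compat A B h →
      ∀ v : α → A.carrier, h (t'.realize v) = r • h (t.realize v) := by
  induction r using freeR_induction generalizing t with
  | mem i =>
    -- The available terms give 1 + r for each generator r; left subtraction of t recovers r itself.
    have main : ∀ t' : qLang.Term α, (∀ (A : Fp.{u}) (B : Mn.{u}) (h : A.carrier ≃ B.carrier),
        Compat A B h → ∀ v : α → A.carrier,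
          h (t'.realize v) = h (t.realize v) + gen i • h (t.realize v)) →
        ∃ t' : qLang.Term α, ∀ (A : Fp.{u}) (B : Mn.{u}) (h : A.carrier ≃ B.carrier),
          Compat A B h → ∀ v : α → A.carrier, h (t'.realize v) = gen i • h (t.realize v) := fun t' ht' =>
      ⟨qLsub t t', fun A B h c v => by
        rw [c.realize_qLsub, ht' A B h c, ← eq_lsub rfl]⟩
    fin_cases i
    · exact main (qMul t qAlpha) fun A B h c v => by
        rw [realize_qMul, realize_qAlpha]
        exact c.mul_alpha_pt _
    · exact main (qMul qBeta t) fun A B h c v => by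
        rw [realize_qMul, realize_qBeta]
        exact c.beta_pt_mul _
    · exact main (qRdiv t qAlpha) fun A B h c v => by
        rw [realize_qRdiv, realize_qAlpha]
        exact c.rdiv_alpha_pt _
    · exact main (qLdiv qBeta t) fun A B h c v => by
        rw [realize_qLdiv, realize_qBeta]
        exact c.ldiv_beta_pt _
  | add r s hr hs =>
    obtain ⟨t₁, h₁⟩ := hr t
    obtain ⟨t₂, h₂⟩ := hs t
    exact ⟨qAdd t₁ t₂, fun A B h c v => by
      rw [c.realize_qAdd, h₁ A B h c, h₂ A B h c, GenModule.add_smul]⟩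
  | neg r hr =>
    obtain ⟨t₁, h₁⟩ := hr t
    refine ⟨qLsub t₁ qPt, fun A B h c v => ?_⟩
    rw [c.realize_qLsub, h₁ A B h c, realize_qPt, c.pt]
    refine (eq_lneg ?_).symm
    rw [← GenModule.add_smul, add_neg_cancel]
    exact zero_smul_eq_zero _
  | mul r s hr hs =>
    obtain ⟨t₁, h₁⟩ := hs t
    obtain ⟨t₂, h₂⟩ := hr t₁
    exact ⟨t₂, fun A B h c v => by rw [h₂ A B h c, h₁ A B h c, GenModule.smul_smul]⟩

omit c in
/-- The operations of generalized modules are given by terms of pointed F-quasigroups. -/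
theorem exists_term_of_mLang {n : ℕ} (f : mLang.Functions n) : ∃ t : qLang.Term (Fin n),
    ∀ (A : Fp.{u}) (B : Mn.{u}) (h : A.carrier ≃ B.carrier), Compat A B h →
      ∀ v : Fin n → A.carrier, Structure.funMap f (fun i => h (v i)) = h (t.realize v) := by
  cases f with
  | zero => exact ⟨qPt, fun A B h c v => c.pt.symm⟩
  | pt => exact ⟨qMul qPt qPt, fun A B h c v => c.pt_mul_pt.symm⟩
  | add => exact ⟨qAdd (.var 0) (.var 1), fun A B h c v => (c.realize_qAdd v (.var 0) (.var 1)).symm⟩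
  | lsub => exact ⟨qLsub (.var 0) (.var 1), fun A B h c v => (c.realize_qLsub v (.var 0) (.var 1)).symm⟩
  | rsub => exact ⟨qRsub (.var 0) (.var 1), fun A B h c v => (c.realize_qRsub v (.var 0) (.var 1)).symm⟩
  | smul r =>
    obtain ⟨t, ht⟩ := exists_smul_term.{u} r (.var (0 : Fin 1))
    exact ⟨t, fun A B h c v => (ht A B h c v).symm⟩

end QTerm

/-! ### Terms of generalized modules -/

section MTerm

open FirstOrder Language

/-- The addition of terms. -/
def mAdd {α : Type} (s t : mLang.Term α) : mLang.Term α :=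
  Functions.apply₂ (MOp.add : mLang.Functions 2) s t

/-- The left subtraction of terms. -/
def mLsub {α : Type} (s t : mLang.Term α) : mLang.Term α :=
  Functions.apply₂ (MOp.lsub : mLang.Functions 2) s t

/-- The right subtraction of terms. -/
def mRsub {α : Type} (s t : mLang.Term α) : mLang.Term α :=
  Functions.apply₂ (MOp.rsub : mLang.Functions 2) s t

/-- The term `t + r t`. -/
noncomputable def mAddSmul {α : Type} (r : FreeR) (t : mLang.Term α) : mLang.Term α :=
  mAdd t (Functions.apply₁ (MOp.smul r : mLang.Functions 1) t)

/-- The distinguished element as a term. -/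
def mPt {α : Type} : mLang.Term α := .func (MOp.pt : mLang.Functions 0) Fin.elim0

variable {α : Type} {B : Mn.{u}} (v : α → B.carrier) (s t : mLang.Term α)

theorem realize_mAdd : (mAdd s t).realize v = s.realize v + t.realize v :=
  Term.realize_functions_apply₂

theorem realize_mLsub : (mLsub s t).realize v = lsub (s.realize v) (t.realize v) :=
  Term.realize_functions_apply₂

theorem realize_mRsub : (mRsub s t).realize v = rsub (s.realize v) (t.realize v) :=
  Term.realize_functions_apply₂

theorem realize_mAddSmul (r : FreeR) :
    (mAddSmul r t).realize v = t.realize v + r • t.realize v := by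
  rw [mAddSmul, realize_mAdd]
  exact congrArg (t.realize v + ·) Term.realize_functions_apply₁

/-- The operations of pointed F-quasigroups are given by terms of generalized modules. -/
theorem exists_term_of_qLang {n : ℕ} (f : qLang.Functions n) : ∃ t : mLang.Term (Fin n),
    ∀ (A : Fp.{u}) (B : Mn.{u}) (h : A.carrier ≃ B.carrier), Compat A B h →
      ∀ v : Fin n → A.carrier, h (Structure.funMap f v) = t.realize fun i => h (v i) := by
  cases f with
  | pt => exact ⟨.func (MOp.zero : mLang.Functions 0) Fin.elim0, fun A B h c v => c.pt⟩
  | mul =>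
    refine ⟨mAdd (mAdd (mAddSmul (gen 0) (.var 0)) mPt) (mAddSmul (gen 1) (.var 1)),
      fun A B h c v => ?_⟩
    rw [realize_mAdd, realize_mAdd, realize_mAddSmul, realize_mAddSmul]
    exact c.mul (v 0) (v 1)
  | ldiv =>
    refine ⟨mAddSmul (gen 3) (mLsub (mAdd (mAddSmul (gen 0) (.var 0)) mPt) (.var 1)),
      fun A B h c v => ?_⟩
    rw [realize_mAddSmul, realize_mLsub, realize_mAdd, realize_mAddSmul]
    exact c.ldiv (v 0) (v 1)
  | rdiv =>
    refine ⟨mAddSmul (gen 2) (mRsub (mRsub (.var 0) (mAddSmul (gen 1) (.var 1))) mPt),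
      fun A B h c v => ?_⟩
    rw [realize_mAddSmul, realize_mRsub, realize_mRsub, realize_mAddSmul]
    exact c.rdiv (v 0) (v 1)

end MTerm

/-! ### Homomorphisms -/

/-- Homomorphisms of pointed quasigroups preserve all operations. -/
noncomputable def Fp.Hom.toLangHom {A A' : Fp.{u}} (k : Fp.Hom A A') :
    FirstOrder.Language.Hom qLang A.carrier A'.carrier where
  toFun := k.toFun
  map_fun' f v := by
    cases f with
    | pt => exact k.map_pt
    | mul => exact k.map_mul _ _
    | ldiv => exact eq_ldiv ((k.map_mul _ _).symm.trans (congrArg k.toFun (mul_ldiv _ _)))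
    | rdiv => exact eq_rdiv ((k.map_mul _ _).symm.trans (congrArg k.toFun (rdiv_mul _ _)))
  map_rel' r := r.elim

namespace Compat

variable {A A' : Fp.{u}} {B B' : Mn.{u}} {h : A.carrier ≃ B.carrier} {h' : A'.carrier ≃ B'.carrier}
  (c : Compat A B h) (c' : Compat A' B' h')

include c c' in
-- A quasigroup homomorphism preserves terms, and each module operation is a term that is uniform
-- over all objects.
theorem map_funMap (k : Fp.Hom A A') {n : ℕ} (f : mLang.Functions n) (v : Fin n → B.carrier) :
    h' (k.toFun (h.symm (FirstOrder.Language.Structure.funMap f v))) =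
      FirstOrder.Language.Structure.funMap f fun i => h' (k.toFun (h.symm (v i))) := by
  obtain ⟨t, ht⟩ := exists_term_of_mLang.{u} f
  have h1 := ht A B h c fun i => h.symm (v i)
  simp only [h.apply_symm_apply] at h1
  rw [h1, h.symm_apply_apply, ht A' B' h' c' fun i => k.toFun (h.symm (v i))]
  exact congrArg h' (FirstOrder.Language.HomClass.realize_term k.toLangHom).symm

/-- The homomorphism of generalized modules with the same underlying map as a homomorphism of
quasigroups. -/
noncomputable def homM (k : A ⟶ A') : B ⟶ B' :=
  ({ toFun := fun x => h' (k.toFun (h.symm x))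
     map_add := fun x y => c.map_funMap c' k (MOp.add : mLang.Functions 2) ![x, y]
     map_smul := fun r x => c.map_funMap c' k (MOp.smul r : mLang.Functions 1) ![x]
     map_pt := c.map_funMap c' k (MOp.pt : mLang.Functions 0) ![] } : Mn.Hom B B')

/-- The homomorphism of quasigroups with the same underlying map as a homomorphism of generalized
modules. -/
noncomputable def homF (k : B ⟶ B') : A ⟶ A' :=
  ({ toFun := fun x => h'.symm (k.toFun (h x))
     map_mul := fun x y => by
      rw [h'.symm_apply_eq, c'.mul, c.mul, k.map_add, k.map_add, k.map_add, k.map_add, k.map_smul,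
        k.map_smul, k.map_pt, h'.apply_symm_apply, h'.apply_symm_apply]
     map_pt := by
      rw [h'.symm_apply_eq, c'.pt, c.pt]
      apply loop_add_left_cancel (a := k.toFun 0)
      rw [← k.map_add, loop_add_zero, loop_add_zero] } : Fp.Hom A A')

end Compat

/-! ### The equivalence -/

/-- The generalized module of a pointed F-quasigroup. -/
noncomputable def Fp.toMn (A : Fp.{u}) : Mn.{u} := (exists_compat_Mn A).choose

/-- The identification of the underlying sets. -/
noncomputable def Fp.equivMn (A : Fp.{u}) : A.carrier ≃ A.toMn.carrier :=
  (exists_compat_Mn A).choose_spec.choose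

theorem Fp.compat (A : Fp.{u}) : Compat A A.toMn A.equivMn :=
  (exists_compat_Mn A).choose_spec.choose_spec

/-- The pointed F-quasigroup of a generalized module. -/
noncomputable def Mn.toFp (B : Mn.{u}) : Fp.{u} := (exists_compat_Fp B).choose

/-- The identification of the underlying sets. -/
noncomputable def Mn.equivFp (B : Mn.{u}) : B.toFp.carrier ≃ B.carrier :=
  (exists_compat_Fp B).choose_spec.choose

theorem Mn.compat (B : Mn.{u}) : Compat B.toFp B B.equivFp :=
  (exists_compat_Fp B).choose_spec.choose_spec

theorem Fp.hom_ext {A A' : Fp.{u}} {k l : A ⟶ A'} (h : ∀ x, Fp.Hom.toFun k x = Fp.Hom.toFun l x) :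
    k = l :=
  Fp.Hom.ext (funext h)

theorem Mn.hom_ext {B B' : Mn.{u}} {k l : B ⟶ B'} (h : ∀ x, Mn.Hom.toFun k x = Mn.Hom.toFun l x) :
    k = l :=
  Mn.Hom.ext (funext h)

theorem Fp.comp_apply {A A' A'' : Fp.{u}} (k : A ⟶ A') (l : A' ⟶ A'') (x : A.carrier) :
    Fp.Hom.toFun (k ≫ l) x = Fp.Hom.toFun l (Fp.Hom.toFun k x) := rfl

theorem Mn.comp_apply {B B' B'' : Mn.{u}} (k : B ⟶ B') (l : B' ⟶ B'') (x : B.carrier) :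
    Mn.Hom.toFun (k ≫ l) x = Mn.Hom.toFun l (Mn.Hom.toFun k x) := rfl

theorem Fp.id_apply {A : Fp.{u}} (x : A.carrier) : Fp.Hom.toFun (𝟙 A) x = x := rfl

theorem Mn.id_apply {B : Mn.{u}} (x : B.carrier) : Mn.Hom.toFun (𝟙 B) x = x := rfl

section

variable {A A' : Fp.{u}} {B B' : Mn.{u}} {h : A.carrier ≃ B.carrier} {h' : A'.carrier ≃ B'.carrier}
  (c : Compat A B h) (c' : Compat A' B' h')

theorem Compat.homM_apply (k : A ⟶ A') (x : B.carrier) :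
    Mn.Hom.toFun (c.homM c' k) x = h' (Fp.Hom.toFun k (h.symm x)) := rfl

theorem Compat.homF_apply (k : B ⟶ B') (x : A.carrier) :
    Fp.Hom.toFun (c.homF c' k) x = h'.symm (Mn.Hom.toFun k (h x)) := rfl

end

/-- The functor from pointed F-quasigroups to generalized modules. -/
noncomputable def functorMn : Fp.{u} ⥤ Mn.{u} where
  obj := Fp.toMn
  map {A A'} k := A.compat.homM A'.compat k
  map_id A := Mn.hom_ext fun x => by
    rw [Compat.homM_apply, Fp.id_apply, Equiv.apply_symm_apply, Mn.id_apply]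
  map_comp k l := Mn.hom_ext fun x => by
    simp only [Compat.homM_apply, Fp.comp_apply, Mn.comp_apply, Equiv.symm_apply_apply]

/-- The functor from generalized modules to pointed F-quasigroups. -/
noncomputable def functorFp : Mn.{u} ⥤ Fp.{u} where
  obj := Mn.toFp
  map {B B'} k := B.compat.homF B'.compat k
  map_id B := Fp.hom_ext fun x => by
    rw [Compat.homF_apply, Mn.id_apply, Equiv.symm_apply_apply, Fp.id_apply]
  map_comp k l := Fp.hom_ext fun x => by
    simp only [Compat.homF_apply, Fp.comp_apply, Mn.comp_apply, Equiv.apply_symm_apply]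

/-- Quasigroups with the same arithmetic form are isomorphic. -/
noncomputable def Compat.isoF {A A' : Fp.{u}} {B : Mn.{u}} {h : A.carrier ≃ B.carrier}
    {h' : A'.carrier ≃ B.carrier} (c : Compat A B h) (c' : Compat A' B h') : A ≅ A' where
  hom := c.homF c' (𝟙 B)
  inv := c'.homF c (𝟙 B)
  hom_inv_id := Fp.hom_ext fun x => by
    simp only [Compat.homF_apply, Fp.comp_apply, Mn.id_apply, Fp.id_apply, Equiv.symm_apply_apply,
      Equiv.apply_symm_apply]
  inv_hom_id := Fp.hom_ext fun x => by
    simp only [Compat.homF_apply, Fp.comp_apply, Mn.id_apply, Fp.id_apply, Equiv.symm_apply_apply,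
      Equiv.apply_symm_apply]

/-- Generalized modules of the same quasigroup are isomorphic. -/
noncomputable def Compat.isoM {A : Fp.{u}} {B B' : Mn.{u}} {h : A.carrier ≃ B.carrier}
    {h' : A.carrier ≃ B'.carrier} (c : Compat A B h) (c' : Compat A B' h') : B ≅ B' where
  hom := c.homM c' (𝟙 A)
  inv := c'.homM c (𝟙 A)
  hom_inv_id := Mn.hom_ext fun x => by
    simp only [Compat.homM_apply, Mn.comp_apply, Mn.id_apply, Fp.id_apply, Equiv.symm_apply_apply,
      Equiv.apply_symm_apply]
  inv_hom_id := Mn.hom_ext fun x => by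
    simp only [Compat.homM_apply, Mn.comp_apply, Mn.id_apply, Fp.id_apply, Equiv.symm_apply_apply,
      Equiv.apply_symm_apply]

/-- The equivalence between pointed F-quasigroups and generalized modules. -/
noncomputable def equivalenceFpMn : Fp.{u} ≌ Mn.{u} :=
  .mk functorMn functorFp
    (NatIso.ofComponents (fun A => A.compat.isoF A.toMn.compat) fun {A A'} k => Fp.hom_ext fun x => by
      show A'.toMn.equivFp.symm (A'.equivMn (Fp.Hom.toFun k x)) = A'.toMn.equivFp.symm
        (A'.equivMn (Fp.Hom.toFun k (A.equivMn.symm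
          (A.toMn.equivFp (A.toMn.equivFp.symm (A.equivMn x))))))
      rw [Equiv.apply_symm_apply, Equiv.symm_apply_apply])
    (NatIso.ofComponents (fun B => B.toFp.compat.isoM B.compat) fun {B B'} k => Mn.hom_ext fun x => by
      show B'.equivFp (B'.toFp.equivMn.symm (B'.toFp.equivMn (B'.equivFp.symm (Mn.Hom.toFun k
          (B.equivFp (B.toFp.equivMn.symm x)))))) =
        Mn.Hom.toFun k (B.equivFp (B.toFp.equivMn.symm x))
      rw [Equiv.symm_apply_apply, Equiv.apply_symm_apply])

/-- The equivalence of the equational classes `𝓕_p` and `𝓜_n`. -/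
noncomputable def equationalEquivalence : EquationalEquivalence.{u} where
  equiv := equivalenceFpMn
  θ := Fp.equivMn
  θ_naturality {A B} f x := by
    show _ = B.equivMn (Fp.Hom.toFun f (A.equivMn.symm (A.equivMn x)))
    rw [Equiv.symm_apply_apply]
    rfl
  exists_mTerm f := by
    obtain ⟨t, ht⟩ := exists_term_of_qLang.{u} f
    exact ⟨t, fun A => ht A _ _ A.compat⟩
  exists_qTerm f := by
    obtain ⟨t, ht⟩ := exists_term_of_mLang.{u} f
    exact ⟨t, fun A => ht A _ _ A.compat⟩

/-! ### Invariance under isomorphism and restriction to full subcategories. -/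

theorem Compat.trans_iso {A : Fp.{u}} {B B' : Mn.{u}} {h : A.carrier ≃ B.carrier}
    (c : Compat A B h) (i : B ≅ B') : ∃ h' : A.carrier ≃ B'.carrier, Compat A B' h' := by
  have hi : ∀ x, Mn.Hom.toFun i.inv (Mn.Hom.toFun i.hom x) = x := fun x => by
    rw [← Mn.comp_apply, i.hom_inv_id, Mn.id_apply]
  have hi' : ∀ x, Mn.Hom.toFun i.hom (Mn.Hom.toFun i.inv x) = x := fun x => by
    rw [← Mn.comp_apply, i.inv_hom_id, Mn.id_apply]
  let e : B.carrier ≃ B'.carrier := ⟨Mn.Hom.toFun i.hom, Mn.Hom.toFun i.inv, hi, hi'⟩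
  have map_add : ∀ x y, e (x + y) = e x + e y := Mn.Hom.map_add i.hom
  have map_smul : ∀ (r : FreeR) x, e (r • x) = r • e x := Mn.Hom.map_smul i.hom
  have map_pt : e B.pt = B'.pt := Mn.Hom.map_pt i.hom
  refine ⟨h.trans e, ?_, fun x y => ?_⟩
  · show e (h A.pt) = 0
    rw [c.pt]
    apply loop_add_left_cancel (a := e 0)
    rw [← map_add, loop_add_zero, loop_add_zero]
  · simp only [Equiv.trans_apply, c.mul, map_add, map_smul, map_pt]

/-- Isomorphic modules share a compatible quasigroup, whose membership in 𝓕_m decides centrality of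
both points. The closure is needed to restrict the equivalence to full subcategories. -/
instance : isMc.{u}.IsClosedUnderIsomorphisms where
  of_iso {B B'} i hB := by
    obtain ⟨h, c⟩ := B.compat.trans_iso i
    exact c.isFm_iff.1 (B.compat.isFm_iff.2 hB)

end FQuasi

theorem mainTheorem1 :
    ∃ E : EquationalEquivalence.{u},
      (∀ A : Fp.{u}, isFm A ↔ isMc (E.equiv.functor.obj A)) ∧
      ∃ E' : isFm.{u}.FullSubcategory ≌ isMc.{u}.FullSubcategory,
        Nonempty (E'.functor ⋙ isMc.ι ≅ isFm.ι ⋙ E.equiv.functor) ∧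
        Nonempty (E'.inverse ⋙ isFm.ι ≅ isMc.ι ⋙ E.equiv.inverse) := by
  have h : ∀ A : Fp.{u}, isFm A ↔ isMc (equivalenceFpMn.functor.obj A) := fun A =>
    A.compat.isFm_iff
  -- The restricted functors commute with the inclusions definitionally, so identity isomorphisms
  -- suffice.
  refine ⟨equationalEquivalence, h, equivalenceFpMn.congrFullSubcategory
    (funext fun A => propext (h A).symm), ⟨Iso.refl _⟩, ⟨Iso.refl _⟩⟩
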